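/- **Theorem (Almost-linear prompt tuning inference).** For a real matrix $M$ write $\|M\|_{\max}=\max_{i,j}|M_{ij}|$, and let $\mathrm{Softmax}$ act on each column of a matrix. For $\delta_F,B,\beta>0$ the problem $\mathrm{APTI}(d,L,L_p,B,\delta_F)$ at inverse temperature $\beta$ is: given $Q_p,K_p,V_p\in\mathbb{R}^{d\times(L_p+L)}$ with $\max\{\|Q_p\|_{\max},\|K_p\|_{\max},\|V_p\|_{\max}\}\le B$, output a matrix $\tilde Z\in\mathbb{R}^{d\times(L_p+L)}$ with $$\big\|\tilde Z-V_p\,\mathrm{Softmax}(\beta K_p^{\top}Q_p)\big\|_{\max}\le\delta_F .$$ Let $n=L_p+L$, and let $d=d(n)\in\mathbb{N}$ and $B(n),\beta(n),\delta_F(n)>0$ be functions of $n$ with $$d=O(\log n),\qquad B=o(\sqrt{\log n}),\qquad \delta_F\ge n^{-c}\ \text{ for some constant } c \text{ and all large } n,$$ and $\beta\,d\,B^2=o(\log n)$; the last condition holds automatically for the normalisation $\beta=1/d$ (and for every $\beta=O(1/d)$). Then there is an algorithm which, for all $L_p,L\ge 0$, solves $\mathrm{APTI}(d(n),L,L_p,B(n),\delta_F(n))$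 at inverse temperature $\beta(n)$ in time $n^{1+o(1)}$. Here an algorithm is a single program for a real random access machine: it receives $L_p$, $L$, $d$, $\beta$ and the entries of $Q_p,K_p,V_p$, stores integers and real numbers in memory with indirect addressing, and in unit time performs one addition, subtraction or comparison of integers, one exact operation $+,-,\times,/$ or comparison of reals, one conversion of an integer to a real, one memory access, or one jump. -/

import Mathlib

open Filter Asymptotics

noncomputable section

/-! ### A real random access machine

The machine has integer registers, real registers, an integer memory and a real memory.
Registers are addressed by constants of the program, memory cells by the content of an integer
register.  Real numbers are manipulated only through exact `+`, `-`, `*`, `/` and the comparison `<`;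
there is no rounding of reals to integers, no transcendental operation and no real constant, and
integers are only added, subtracted and compared.  Each instruction costs one time unit. -/

inductive RInstr : Type
  /-- integer constant: `ireg a := k` -/
  | iconst (a k : ℕ)
  /-- integer sum: `ireg a := ireg b + ireg c` -/
  | iadd (a b c : ℕ)
  /-- integer truncated difference: `ireg a := ireg b - ireg c` -/
  | isub (a b c : ℕ)
  /-- `ireg a := imem (ireg b)` -/
  | iload (a b : ℕ)
  /-- `imem (ireg a) := ireg b` -/
  | istore (a b : ℕ)
  /-- integer to real: `freg a := ireg b` -/
  | fcast (a b : ℕ)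
  /-- `freg a := freg b + freg c` -/
  | fadd (a b c : ℕ)
  /-- `freg a := freg b - freg c` -/
  | fsub (a b c : ℕ)
  /-- `freg a := freg b * freg c` -/
  | fmul (a b c : ℕ)
  /-- `freg a := freg b / freg c` -/
  | fdiv (a b c : ℕ)
  /-- `freg a := fmem (ireg b)` -/
  | fload (a b : ℕ)
  /-- `fmem (ireg a) := freg b` -/
  | fstore (a b : ℕ)
  /-- go to instruction `k` -/
  | jump (k : ℕ)
  /-- go to instruction `k` if `ireg a < ireg b` -/
  | ijlt (a b k : ℕ)
  /-- go to instruction `k` if `freg a < freg b` -/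
  | fjlt (a b k : ℕ)

/-- A configuration of the machine; `pc` is the index of the next instruction. -/
@[ext]
structure RState : Type where
  pc : ℕ
  ireg : ℕ → ℕ
  freg : ℕ → ℝ
  imem : ℕ → ℕ
  fmem : ℕ → ℝ

open Classical in
/-- The effect of one instruction. -/
def RInstr.exec (I : RInstr) (s : RState) : RState :=
  match I with
  | .iconst a k => { s with pc := s.pc + 1, ireg := Function.update s.ireg a k }
  | .iadd a b c =>
      { s with pc := s.pc + 1, ireg := Function.update s.ireg a (s.ireg b + s.ireg c) }
  | .isub a b c =>
      { s with pc := s.pc + 1, ireg := Function.update s.ireg a (s.ireg b - s.ireg c) }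
  | .iload a b =>
      { s with pc := s.pc + 1, ireg := Function.update s.ireg a (s.imem (s.ireg b)) }
  | .istore a b =>
      { s with pc := s.pc + 1, imem := Function.update s.imem (s.ireg a) (s.ireg b) }
  | .fcast a b =>
      { s with pc := s.pc + 1, freg := Function.update s.freg a ((s.ireg b : ℕ) : ℝ) }
  | .fadd a b c =>
      { s with pc := s.pc + 1, freg := Function.update s.freg a (s.freg b + s.freg c) }
  | .fsub a b c =>
      { s with pc := s.pc + 1, freg := Function.update s.freg a (s.freg b - s.freg c) }
  | .fmul a b c =>
      { s with pc := s.pc + 1, freg := Function.update s.freg a (s.freg b * s.freg c) }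
  | .fdiv a b c =>
      { s with pc := s.pc + 1, freg := Function.update s.freg a (s.freg b / s.freg c) }
  | .fload a b =>
      { s with pc := s.pc + 1, freg := Function.update s.freg a (s.fmem (s.ireg b)) }
  | .fstore a b =>
      { s with pc := s.pc + 1, fmem := Function.update s.fmem (s.ireg a) (s.freg b) }
  | .jump k => { s with pc := k }
  | .ijlt a b k => { s with pc := if s.ireg a < s.ireg b then k else s.pc + 1 }
  | .fjlt a b k => { s with pc := if s.freg a < s.freg b then k else s.pc + 1 }

/-- A program is a finite list of instructions. -/
abbrev RProgram : Type := List RInstr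

namespace RProgram

/-- The machine has halted when the program counter points outside the program. -/
def Halted (P : RProgram) (s : RState) : Prop := P.length ≤ s.pc

/-- One step of the computation; a halted machine does not move. -/
def step (P : RProgram) (s : RState) : RState :=
  match P[s.pc]? with
  | some I => I.exec s
  | none => s

/-- The configuration after `t` steps. -/
def run (P : RProgram) (t : ℕ) (s : RState) : RState := P.step^[t] s

end RProgram

/-! ### Prompt tuning inference -/

/-- `‖M‖_max = max_{i,j} |M i j|` (zero for a matrix without entries). -/
def maxNorm {a b : ℕ} (M : Matrix (Fin a) (Fin b) ℝ) : ℝ := ⨆ p : Fin a × Fin b, |M p.1 p.2|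

theorem maxNorm_le_iff {a b : ℕ} (M : Matrix (Fin a) (Fin b) ℝ) {r : ℝ} (hr : 0 ≤ r) :
    maxNorm M ≤ r ↔ ∀ i j, |M i j| ≤ r := by
  constructor
  · intro h i j
    exact (le_ciSup (f := fun p : Fin a × Fin b => |M p.1 p.2|)
      (Set.finite_range _).bddAbove (i, j)).trans h
  · intro h
    exact Real.iSup_le (fun p => h p.1 p.2) hr

/-- The softmax of every column of a matrix. -/
def colSoftmax {a b : ℕ} (M : Matrix (Fin a) (Fin b) ℝ) : Matrix (Fin a) (Fin b) ℝ :=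
  Matrix.of fun i j => Real.exp (M i j) / ∑ k, Real.exp (M k j)

/-- The attention `V Softmax(β Kᵀ Q)` with inverse temperature `β`. -/
def attention {d n : ℕ} (β : ℝ) (Q K V : Matrix (Fin d) (Fin n) ℝ) : Matrix (Fin d) (Fin n) ℝ :=
  V * colSoftmax (β • (K.transpose * Q))

/-- A `d × n` matrix written column by column: entry `(i, j)` stands at address `d * j + i`. -/
def flatten {d n : ℕ} (M : Matrix (Fin d) (Fin n) ℝ) (m : ℕ) : ℝ :=
  if h : m % d < d ∧ m / d < n then M ⟨m % d, h.1⟩ ⟨m / d, h.2⟩ else 0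

theorem flatten_apply {d n : ℕ} (M : Matrix (Fin d) (Fin n) ℝ) (i : Fin d) (j : Fin n) :
    flatten M (d * j + i) = M i j := by
  have hd : 0 < d := i.pos
  have h1 : (d * (j : ℕ) + i) % d = i := by
    rw [Nat.mul_add_mod, Nat.mod_eq_of_lt i.isLt]
  have h2 : (d * (j : ℕ) + i) / d = j := by
    rw [Nat.mul_add_div hd, Nat.div_eq_of_lt i.isLt, Nat.add_zero]
  simp [flatten, h1, h2]

/-- The initial configuration: integer registers `0`, `1`, `2` hold `Lp`, `L`, `d`, real register `0`
holds `β`, the real memory starts with the entries of `Q`, then those of `K`, then those of `V`, and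
everything else is zero. -/
def aptiInput (Lp L d : ℕ) (β : ℝ) (Q K V : Matrix (Fin d) (Fin (Lp + L)) ℝ) : RState where
  pc := 0
  ireg := fun a => if a = 0 then Lp else if a = 1 then L else if a = 2 then d else 0
  freg := fun a => if a = 0 then β else 0
  imem := fun _ => 0
  fmem := fun m =>
    if m < d * (Lp + L) then flatten Q m
    else if m < 2 * (d * (Lp + L)) then flatten K (m - d * (Lp + L))
    else flatten V (m - 2 * (d * (Lp + L)))

/-- The output of a computation: the `d × n` matrix at the beginning of the real memory. -/
def readOutput (d n : ℕ) (s : RState) : Matrix (Fin d) (Fin n) ℝ :=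
  Matrix.of fun i j => s.fmem (d * (j : ℕ) + (i : ℕ))

/-- `P` solves approximate prompt tuning inference with parameters `d`, `L`, `Lp`, `B`, `δ` (at inverse
temperature `β`) within `t` steps: on all `Q`, `K`, `V` with entries of modulus at most `B` it has
halted after `t` steps, with an output within `δ` of `V Softmax(β Kᵀ Q)` in the max norm. -/
def RProgram.SolvesAPTI (P : RProgram) (d L Lp : ℕ) (β B δ : ℝ) (t : ℕ) : Prop :=
  ∀ Q K V : Matrix (Fin d) (Fin (Lp + L)) ℝ,
    max (max (maxNorm Q) (maxNorm K)) (maxNorm V) ≤ B →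
      P.Halted (P.run t (aptiInput Lp L d β Q K V)) ∧
      maxNorm (readOutput d (Lp + L) (P.run t (aptiInput Lp L d β Q K V)) - attention β Q K V) ≤ δ

/-- `T n ≤ n ^ (1 + o(1))`. -/
def AlmostLinear (T : ℕ → ℕ) : Prop :=
  ∃ e : ℕ → ℝ, Tendsto e atTop (nhds 0) ∧ ∀ᶠ n : ℕ in atTop, (T n : ℝ) ≤ (n : ℝ) ^ (1 + e n)

end

open Filter Asymptotics

noncomputable section

/-! ### A structured language for the machine -/

/-! Expand the exponential in the softmax up to total degree `G`. With `φ_α(k) = ∏ k_l ^ α_l` and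
`ψ_α(q) = ∏ (β q_l) ^ α_l / α_l!`, the sum of `φ_α(k) ψ_α(q)` over `|α| ≤ G` is the truncated
exponential series at `β ⟨k, q⟩` (`boxSum_monomial`). This replaces the matrix of weights by one of
rank at most `(d + G).choose d`. For each `α` the sums over the columns of `K` and `V` are formed
first and then distributed over the columns of `Q`, in time linear in `n` up to factors polynomial
in `d` and `G`. Numerators and denominators are accumulated in this way, and one division per entry
finishes.

Accuracy: if all entries have modulus at most `M`, the scores are bounded by `X = β d M²`. Put `q =
(2X)^G / G!`. When `2X ≤ G`, truncation changes every weight by a relative error of at most `2q`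
(`abs_expTrunc_sub_exp_le`), and then, if `2q ≤ 1/2`, the weighted mean moves by at most `8Mq`
(`abs_weighted_mean_sub_le`). Hence it suffices that `W q ≤ 1` for `W = (M + 1) N (n + 1)^c`, where
`N` and `c` are constants with `8 / (N (n + 1)^c) ≤ δ n`.

Time: for `M = B n`, `W` is polynomially bounded and `2X = o(log n)`, so the least such `G` is
`o(log n)` (`leastOrder_le_log`). Together with `d = O(log n)` this makes the binomial coefficient
`n^o(1)` (`subpolynomial_choose`).

Only `N` and `c` are built into the program, which finds `M` and `G` itself and needs neither `B`
nor `δ`. On the machine side, a structured language is compiled with exact step counts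
(`RProgram.run_exec`), and an odometer in integer memory enumerates the multi-indices
(`exists_iterate_nextIndex_zero`). -/

/-- A configuration without its program counter. -/
@[ext]
structure Store : Type where
  ireg : ℕ → ℕ
  freg : ℕ → ℝ
  imem : ℕ → ℕ
  fmem : ℕ → ℝ

/-- The configuration with the given store and program counter. -/
def Store.at (s : Store) (p : ℕ) : RState := ⟨p, s.ireg, s.freg, s.imem, s.fmem⟩

/-- The store of a configuration. -/
def RState.store (s : RState) : Store := ⟨s.ireg, s.freg, s.imem, s.fmem⟩

namespace RInstr

/-- The instruction is not a jump. -/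
def isOp : RInstr → Bool
  | .jump _ => false
  | .ijlt _ _ _ => false
  | .fjlt _ _ _ => false
  | _ => true

/-- The effect of an instruction on the store. -/
def act (I : RInstr) (s : Store) : Store := (I.exec (s.at 0)).store

theorem exec_at {I : RInstr} (h : I.isOp = true) (s : Store) (p : ℕ) :
    I.exec (s.at p) = (I.act s).at (p + 1) := by
  cases I <;> first | rfl | simp [isOp] at h

end RInstr

/-- The effect of a list of instructions on the store. -/
def acts (l : List RInstr) (s : Store) : Store := l.foldl (fun s I => I.act s) s

theorem acts_nil (s : Store) : acts [] s = s := rfl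

theorem acts_cons (I : RInstr) (l : List RInstr) (s : Store) :
    acts (I :: l) s = acts l (I.act s) := rfl

/-- Structured programs. -/
inductive Cmd : Type
  | block (l : List RInstr)
  | seq (c₁ c₂ : Cmd)
  | iwhile (a b : ℕ) (c : Cmd)
  | fwhile (a b : ℕ) (c : Cmd)

infixr:60 " ;; " => Cmd.seq

namespace Cmd

/-- The number of machine instructions of the compiled program. -/
def size : Cmd → ℕ
  | block l => l.length
  | seq c₁ c₂ => c₁.size + c₂.size
  | iwhile _ _ c => c.size + 3
  | fwhile _ _ c => c.size + 3

/-- Compilation to machine code that starts at address `k`. -/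
def compile : ℕ → Cmd → List RInstr
  | _, block l => l
  | k, seq c₁ c₂ => compile k c₁ ++ compile (k + c₁.size) c₂
  | k, iwhile a b c =>
      [.ijlt a b (k + 2), .jump (k + c.size + 3)] ++ compile (k + 2) c ++ [.jump k]
  | k, fwhile a b c =>
      [.fjlt a b (k + 2), .jump (k + c.size + 3)] ++ compile (k + 2) c ++ [.jump k]

theorem length_compile (c : Cmd) (k : ℕ) : (c.compile k).length = c.size := by
  induction c generalizing k with
  | block l => rfl
  | seq c₁ c₂ h₁ h₂ => simp [compile, size, h₁, h₂]
  | iwhile a b c h => simp [compile, size, h]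
  | fwhile a b c h => simp [compile, size, h]

/-- `Exec c s t s'`: from the store `s` the program `c` stops after `t` steps in the store `s'`. -/
inductive Exec : Cmd → Store → ℕ → Store → Prop
  | block {l : List RInstr} {s : Store} (h : ∀ I ∈ l, I.isOp = true) :
      Exec (.block l) s l.length (acts l s)
  | seq {c₁ c₂ : Cmd} {s s' s'' : Store} {t t' : ℕ} (h₁ : Exec c₁ s t s') (h₂ : Exec c₂ s' t' s'') :
      Exec (.seq c₁ c₂) s (t + t') s''
  | iwhile_done {a b : ℕ} {c : Cmd} {s : Store} (h : ¬ s.ireg a < s.ireg b) :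
      Exec (.iwhile a b c) s 2 s
  | iwhile_step {a b : ℕ} {c : Cmd} {s s' s'' : Store} {t t' : ℕ} (h : s.ireg a < s.ireg b)
      (h₁ : Exec c s t s') (h₂ : Exec (.iwhile a b c) s' t' s'') :
      Exec (.iwhile a b c) s (t + 2 + t') s''
  | fwhile_done {a b : ℕ} {c : Cmd} {s : Store} (h : ¬ s.freg a < s.freg b) :
      Exec (.fwhile a b c) s 2 s
  | fwhile_step {a b : ℕ} {c : Cmd} {s s' s'' : Store} {t t' : ℕ} (h : s.freg a < s.freg b)
      (h₁ : Exec c s t s') (h₂ : Exec (.fwhile a b c) s' t' s'') :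
      Exec (.fwhile a b c) s (t + 2 + t') s''

end Cmd

/-! ### Correctness of the compilation. -/

namespace RProgram

theorem run_add (P : RProgram) (t t' : ℕ) (s : RState) :
    P.run (t + t') s = P.run t' (P.run t s) := by
  simp only [run]
  rw [Nat.add_comm, Function.iterate_add_apply]

theorem run_one (P : RProgram) (s : RState) : P.run 1 s = P.step s := rfl

theorem step_of_getElem? {P : RProgram} {s : RState} {I : RInstr} (h : P[s.pc]? = some I) :
    P.step s = I.exec s := by
  simp [step, h]

theorem step_append {pre post : List RInstr} {I : RInstr} {s : RState} (h : s.pc = pre.length) :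
    RProgram.step (pre ++ I :: post) s = I.exec s := by
  apply step_of_getElem?
  simp [h]

theorem run_block (pre l post : List RInstr) (h : ∀ I ∈ l, I.isOp = true) (s : Store) :
    RProgram.run (pre ++ l ++ post) l.length (s.at pre.length)
      = (acts l s).at (pre.length + l.length) := by
  induction l generalizing pre s with
  | nil => rfl
  | cons I l ih =>
    have h1 : RProgram.step (pre ++ (I :: l) ++ post) (s.at pre.length)
        = (I.act s).at (pre.length + 1) := by
      rw [List.append_assoc, List.cons_append, step_append rfl,
        RInstr.exec_at (h I (by simp))]
    have h2 := ih (pre ++ [I]) (fun J hJ => h J (by simp [hJ])) (I.act s)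
    simp only [List.append_assoc, List.length_append, List.length_singleton,
      List.cons_append, List.nil_append] at h2
    rw [List.length_cons, Nat.add_comm, run_add, run_one, h1]
    simp only [List.append_assoc, List.cons_append]
    rw [h2, acts_cons]
    congr 1
    omega

/-- Jump targets are absolute, so the induction on the execution needs the code embedded between
arbitrary `pre` and `post` and compiled for the address `pre.length`. -/
theorem run_exec {c : Cmd} {s s' : Store} {t : ℕ} (h : c.Exec s t s') (pre post : List RInstr) :
    RProgram.run (pre ++ c.compile pre.length ++ post) t (s.at pre.length)
      = s'.at (pre.length + c.size) := by
  induction h generalizing pre post with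
  | block h => exact run_block _ _ _ h _
  | @seq c₁ c₂ s s' s'' t t' h₁ h₂ ih₁ ih₂ =>
    have e₁ := ih₁ pre (c₂.compile (pre.length + c₁.size) ++ post)
    have e₂ := ih₂ (pre ++ c₁.compile pre.length) post
    rw [List.length_append, Cmd.length_compile] at e₂
    simp only [Cmd.compile, Cmd.size, List.append_assoc] at e₁ e₂ ⊢
    rw [run_add, e₁, e₂, Nat.add_assoc]
  | @iwhile_done a b c s h =>
    rw [show 2 = 1 + 1 from rfl, run_add, run_one, run_one]
    simp only [Cmd.compile, Cmd.size, List.append_assoc, List.cons_append, List.nil_append]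
    rw [step_append (s := s.at pre.length) rfl]
    have : (RInstr.ijlt a b (pre.length + 2)).exec (s.at pre.length) = s.at (pre.length + 1) := by
      simp [RInstr.exec, Store.at, h]
    rw [this]
    have := step_append (pre := pre ++ [RInstr.ijlt a b (pre.length + 2)])
      (I := .jump (pre.length + c.size + 3)) (s := s.at (pre.length + 1))
      (post := c.compile (pre.length + 2) ++ RInstr.jump pre.length :: post) (by simp [Store.at])
    simp only [List.append_assoc, List.cons_append, List.nil_append] at this
    rw [this]
    rfl
  | @iwhile_step a b c s s' s'' t t' h h₁ h₂ ih₁ ih₂ =>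
    have e₂ := ih₂ pre post
    have e₁ := ih₁ (pre ++ [RInstr.ijlt a b (pre.length + 2), .jump (pre.length + c.size + 3)])
      (RInstr.jump pre.length :: post)
    simp only [Cmd.compile, Cmd.size, List.append_assoc, List.cons_append, List.nil_append,
      List.length_append, List.length_cons, List.length_nil, Nat.zero_add, Nat.reduceAdd]
      at e₁ e₂ ⊢
    -- The successful test, the body, the jump back, and the remaining passes.
    rw [show t + 2 + t' = 1 + t + 1 + t' by omega, run_add, run_add, run_add]
    simp only [run_one]
    rw [step_append (s := s.at pre.length) rfl]
    have : (RInstr.ijlt a b (pre.length + 2)).exec (s.at pre.length) = s.at (pre.length + 2) := by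
      simp [RInstr.exec, Store.at, h]
    rw [this, e₁]
    have := step_append (pre := pre ++ [RInstr.ijlt a b (pre.length + 2),
        .jump (pre.length + c.size + 3)] ++ c.compile (pre.length + 2))
      (I := .jump pre.length) (s := s'.at (pre.length + 2 + c.size))
      (post := post) (by simp [Store.at, Cmd.length_compile]; omega)
    simp only [List.append_assoc, List.cons_append, List.nil_append] at this
    rw [this]
    exact e₂
  | @fwhile_done a b c s h =>
    rw [show 2 = 1 + 1 from rfl, run_add, run_one, run_one]
    simp only [Cmd.compile, Cmd.size, List.append_assoc, List.cons_append, List.nil_append]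
    rw [step_append (s := s.at pre.length) rfl]
    have : (RInstr.fjlt a b (pre.length + 2)).exec (s.at pre.length) = s.at (pre.length + 1) := by
      simp [RInstr.exec, Store.at, h]
    rw [this]
    have := step_append (pre := pre ++ [RInstr.fjlt a b (pre.length + 2)])
      (I := .jump (pre.length + c.size + 3)) (s := s.at (pre.length + 1))
      (post := c.compile (pre.length + 2) ++ RInstr.jump pre.length :: post) (by simp [Store.at])
    simp only [List.append_assoc, List.cons_append, List.nil_append] at this
    rw [this]
    rfl
  | @fwhile_step a b c s s' s'' t t' h h₁ h₂ ih₁ ih₂ =>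
    have e₂ := ih₂ pre post
    have e₁ := ih₁ (pre ++ [RInstr.fjlt a b (pre.length + 2), .jump (pre.length + c.size + 3)])
      (RInstr.jump pre.length :: post)
    simp only [Cmd.compile, Cmd.size, List.append_assoc, List.cons_append, List.nil_append,
      List.length_append, List.length_cons, List.length_nil, Nat.zero_add, Nat.reduceAdd]
      at e₁ e₂ ⊢
    rw [show t + 2 + t' = 1 + t + 1 + t' by omega, run_add, run_add, run_add]
    simp only [run_one]
    rw [step_append (s := s.at pre.length) rfl]
    have : (RInstr.fjlt a b (pre.length + 2)).exec (s.at pre.length) = s.at (pre.length + 2) := by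
      simp [RInstr.exec, Store.at, h]
    rw [this, e₁]
    have := step_append (pre := pre ++ [RInstr.fjlt a b (pre.length + 2),
        .jump (pre.length + c.size + 3)] ++ c.compile (pre.length + 2))
      (I := .jump pre.length) (s := s'.at (pre.length + 2 + c.size))
      (post := post) (by simp [Store.at, Cmd.length_compile]; omega)
    simp only [List.append_assoc, List.cons_append, List.nil_append] at this
    rw [this]
    exact e₂

theorem run_of_halted {P : RProgram} {s : RState} (h : P.Halted s) (t : ℕ) : P.run t s = s := by
  have h1 : P.step s = s := by
    simp only [step]
    rw [List.getElem?_eq_none h]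
  exact Function.iterate_fixed h1 t

end RProgram

/-! ### Total correctness with time bounds. -/

namespace Cmd

/-- From the store `s` the program `c` stops within `t` steps in a store that satisfies `Q`. -/
def Wp (c : Cmd) (t : ℕ) (Q : Store → Prop) (s : Store) : Prop :=
  ∃ t' ≤ t, ∃ s', c.Exec s t' s' ∧ Q s'

theorem Wp.mono {c : Cmd} {t t' : ℕ} {Q Q' : Store → Prop} {s : Store} (h : c.Wp t Q s)
    (ht : t ≤ t') (hQ : ∀ s', Q s' → Q' s') : c.Wp t' Q' s := by
  obtain ⟨u, hu, s', he, hq⟩ := h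
  exact ⟨u, hu.trans ht, s', he, hQ _ hq⟩

theorem wp_block {l : List RInstr} {t : ℕ} {Q : Store → Prop} {s : Store}
    (ho : l.all RInstr.isOp = true) (ht : l.length ≤ t) (hQ : Q (acts l s)) :
    (block l).Wp t Q s :=
  ⟨_, ht, _, .block (by simpa using ho), hQ⟩

theorem Wp.seq {c₁ c₂ : Cmd} {t₁ t₂ t : ℕ} {R Q : Store → Prop} {s : Store}
    (h₁ : c₁.Wp t₁ R s) (h₂ : ∀ s', R s' → c₂.Wp t₂ Q s') (ht : t₁ + t₂ ≤ t) :
    (c₁ ;; c₂).Wp t Q s := by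
  obtain ⟨u, hu, s', he, hr⟩ := h₁
  obtain ⟨u', hu', s'', he', hq⟩ := h₂ _ hr
  exact ⟨u + u', by omega, s'', .seq he he', hq⟩

/-- A leading block is executed symbolically. -/
theorem wp_block_seq {l : List RInstr} {c : Cmd} {t t' : ℕ} {Q : Store → Prop} {s : Store}
    (ho : l.all RInstr.isOp = true) (h : c.Wp t Q (acts l s)) (ht : l.length + t ≤ t') :
    (block l ;; c).Wp t' Q s :=
  Wp.seq (R := fun s' => s' = acts l s) (wp_block ho le_rfl rfl) (by rintro _ rfl; exact h) ht

theorem wp_iwhile_done {a b : ℕ} {c : Cmd} {t : ℕ} {Q : Store → Prop} {s : Store}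
    (h : ¬ s.ireg a < s.ireg b) (ht : 2 ≤ t) (hQ : Q s) : (iwhile a b c).Wp t Q s :=
  ⟨2, ht, s, .iwhile_done h, hQ⟩

theorem wp_iwhile_step {a b : ℕ} {c : Cmd} {t₁ t₂ t : ℕ} {R Q : Store → Prop} {s : Store}
    (h : s.ireg a < s.ireg b) (h₁ : c.Wp t₁ R s) (h₂ : ∀ s', R s' → (iwhile a b c).Wp t₂ Q s')
    (ht : t₁ + 2 + t₂ ≤ t) : (iwhile a b c).Wp t Q s := by
  obtain ⟨u, hu, s', he, hr⟩ := h₁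
  obtain ⟨u', hu', s'', he', hq⟩ := h₂ _ hr
  exact ⟨u + 2 + u', by omega, s'', .iwhile_step h he he', hq⟩

theorem wp_fwhile_done {a b : ℕ} {c : Cmd} {t : ℕ} {Q : Store → Prop} {s : Store}
    (h : ¬ s.freg a < s.freg b) (ht : 2 ≤ t) (hQ : Q s) : (fwhile a b c).Wp t Q s :=
  ⟨2, ht, s, .fwhile_done h, hQ⟩

theorem wp_fwhile_step {a b : ℕ} {c : Cmd} {t₁ t₂ t : ℕ} {R Q : Store → Prop} {s : Store}
    (h : s.freg a < s.freg b) (h₁ : c.Wp t₁ R s) (h₂ : ∀ s', R s' → (fwhile a b c).Wp t₂ Q s')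
    (ht : t₁ + 2 + t₂ ≤ t) : (fwhile a b c).Wp t Q s := by
  obtain ⟨u, hu, s', he, hr⟩ := h₁
  obtain ⟨u', hu', s'', he', hq⟩ := h₂ _ hr
  exact ⟨u + 2 + u', by omega, s'', .fwhile_step h he he', hq⟩

/-- An integer loop with `N` passes. -/
theorem wp_iwhile {a b : ℕ} {c : Cmd} {N tb t : ℕ} {Q : Store → Prop} {s : Store}
    (Inv : ℕ → Store → Prop) (h0 : Inv 0 s)
    (hgo : ∀ k < N, ∀ s, Inv k s → s.ireg a < s.ireg b)
    (hexit : ∀ s, Inv N s → ¬ s.ireg a < s.ireg b)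
    (hbody : ∀ k < N, ∀ s, Inv k s → c.Wp tb (Inv (k + 1)) s)
    (hQ : ∀ s, Inv N s → Q s) (ht : N * (tb + 2) + 2 ≤ t) : (iwhile a b c).Wp t Q s := by
  have key : ∀ m k s, k + m = N → Inv k s → (iwhile a b c).Wp (m * (tb + 2) + 2) Q s := by
    intro m
    induction m with
    | zero =>
      intro k s hk hs
      obtain rfl : k = N := by omega
      exact wp_iwhile_done (hexit s hs) (by omega) (hQ s hs)
    | succ m ih =>
      intro k s hk hs
      exact wp_iwhile_step (hgo k (by omega) s hs) (hbody k (by omega) s hs)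
        (fun s' hs' => ih (k + 1) s' (by omega) hs') (by rw [Nat.succ_mul]; omega)
  exact (key N 0 s (by omega) h0).mono ht fun _ h => h

/-- A real loop with `N` passes. -/
theorem wp_fwhile {a b : ℕ} {c : Cmd} {N tb t : ℕ} {Q : Store → Prop} {s : Store}
    (Inv : ℕ → Store → Prop) (h0 : Inv 0 s)
    (hgo : ∀ k < N, ∀ s, Inv k s → s.freg a < s.freg b)
    (hexit : ∀ s, Inv N s → ¬ s.freg a < s.freg b)
    (hbody : ∀ k < N, ∀ s, Inv k s → c.Wp tb (Inv (k + 1)) s)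
    (hQ : ∀ s, Inv N s → Q s) (ht : N * (tb + 2) + 2 ≤ t) : (fwhile a b c).Wp t Q s := by
  have key : ∀ m k s, k + m = N → Inv k s → (fwhile a b c).Wp (m * (tb + 2) + 2) Q s := by
    intro m
    induction m with
    | zero =>
      intro k s hk hs
      obtain rfl : k = N := by omega
      exact wp_fwhile_done (hexit s hs) (by omega) (hQ s hs)
    | succ m ih =>
      intro k s hk hs
      exact wp_fwhile_step (hgo k (by omega) s hs) (hbody k (by omega) s hs)
        (fun s' hs' => ih (k + 1) s' (by omega) hs') (by rw [Nat.succ_mul]; omega)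
  exact (key N 0 s (by omega) h0).mono ht fun _ h => h

/-- The loop `for r = 0, …, ireg b - 1`; integer register `7` has to hold the number one. -/
def loop (r b : ℕ) (c : Cmd) : Cmd := block [.iconst r 0] ;; iwhile r b (c ;; block [.iadd r r 7])

/-- A counting loop; the invariant may not depend on the loop register. -/
theorem wp_loop {r b : ℕ} {c : Cmd} {N tb t : ℕ} {Q : Store → Prop} {s : Store}
    (Inv : ℕ → Store → Prop)
    (hInv : ∀ k s v, Inv k s → Inv k { s with ireg := Function.update s.ireg r v })
    (h0 : Inv 0 s) (hreg : ∀ k s, Inv k s → s.ireg b = N ∧ s.ireg 7 = 1)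
    (hbody : ∀ k < N, ∀ s, Inv k s → s.ireg r = k →
      c.Wp tb (fun s' => Inv (k + 1) s' ∧ s'.ireg r = k) s)
    (hQ : ∀ s, Inv N s → Q s) (ht : N * (tb + 3) + 3 ≤ t) : (loop r b c).Wp t Q s := by
  refine wp_block_seq rfl (t := N * (tb + 1 + 2) + 2) ?_
    (by rw [List.length_singleton, show tb + 1 + 2 = tb + 3 from rfl]; omega)
  refine wp_iwhile (N := N) (tb := tb + 1) (fun k s => Inv k s ∧ s.ireg r = k) ⟨hInv 0 s 0 h0, ?_⟩
    ?_ ?_ ?_ (fun s h => hQ s h.1) le_rfl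
  · exact Function.update_self ..
  · rintro k hk s ⟨hs, hsr⟩
    rw [hsr, (hreg k s hs).1]; exact hk
  · rintro s ⟨hs, hsr⟩
    rw [hsr, (hreg N s hs).1]; exact lt_irrefl _
  · rintro k hk s ⟨hs, hsr⟩
    refine Wp.seq (hbody k hk s hs hsr) ?_ le_rfl
    rintro s' ⟨hs', hsr'⟩
    refine wp_block rfl le_rfl ⟨hInv (k + 1) s' _ hs', ?_⟩
    change Function.update s'.ireg r (s'.ireg r + s'.ireg 7) r = k + 1
    rw [Function.update_self, hsr', (hreg _ _ hs').2]

/-- The compiled program halts within the time of the structured program. -/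
theorem Wp.run {c : Cmd} {t : ℕ} {Q : Store → Prop} {s : Store} (h : c.Wp t Q s) :
    RProgram.Halted (c.compile 0) (RProgram.run (c.compile 0) t (s.at 0)) ∧
      Q (RProgram.run (c.compile 0) t (s.at 0)).store := by
  obtain ⟨u, hu, s', he, hq⟩ := h
  have h1 := RProgram.run_exec he [] []
  simp only [List.nil_append, List.append_nil, List.length_nil, Nat.zero_add] at h1
  have h2 : RProgram.Halted (c.compile 0) (s'.at c.size) := by
    simp [RProgram.Halted, length_compile, Store.at]
  obtain ⟨v, rfl⟩ := Nat.exists_eq_add_of_le hu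
  rw [RProgram.run_add, h1, RProgram.run_of_halted h2]
  exact ⟨h2, hq⟩

end Cmd

/-! ### The odometer -/

/-- The sum of the first `d + 1` entries. -/
def total (d : ℕ) (α : ℕ → ℕ) : ℕ := ∑ l ∈ Finset.range (d + 1), α l

/-- Increment entry `i`. -/
def bump (α : ℕ → ℕ) (i : ℕ) : ℕ → ℕ := Function.update α i (α i + 1)

/-- Increment entry `i`; as long as the total exceeds `G`, clear the entry and go on to the next one,
for at most `fuel` times. -/
def carry (d G : ℕ) : ℕ → ℕ → (ℕ → ℕ) → ℕ → ℕ
  | 0, i, α => bump α i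
  | fuel + 1, i, α =>
      if G < total d (bump α i) then carry d G fuel (i + 1) (Function.update α i 0) else bump α i

/-- The multi-index that follows `α`. -/
def nextIndex (d G : ℕ) (α : ℕ → ℕ) : ℕ → ℕ := carry d G d 0 α

/-- The sum of `f` over all multi-indices obtained from `α` by raising the first `i` entries by at
most `r` altogether. -/
def boxSum {M : Type*} [AddCommMonoid M] (f : (ℕ → ℕ) → M) : ℕ → ℕ → (ℕ → ℕ) → M
  | 0, _, α => f α
  | i + 1, r, α =>
      ∑ a ∈ Finset.range (r + 1), boxSum f i (r - a) (Function.update α i (α i + a))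

theorem total_update {d i : ℕ} (hi : i ≤ d) (α : ℕ → ℕ) (v : ℕ) :
    total d (Function.update α i v) + α i = total d α + v := by
  have h : i ∈ Finset.range (d + 1) := Finset.mem_range.2 (by omega)
  simp only [total]
  rw [Finset.sum_update_of_mem h, ← Finset.add_sum_erase _ α h, Finset.sdiff_singleton_eq_erase]
  omega

theorem total_bump {d i : ℕ} (hi : i ≤ d) (α : ℕ → ℕ) : total d (bump α i) = total d α + 1 := by
  have := total_update hi α (α i + 1)
  simp only [bump]
  omega

/-- Starting from a multi-index whose first `i` entries vanish, the odometer runs once through the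
multi-indices that differ from it in these entries, and then carries to entry `i`. -/
theorem exists_iterate_nextIndex {M : Type*} [AddCommMonoid M] (f : (ℕ → ℕ) → M) (d G : ℕ) (i : ℕ)
    (hi : i ≤ d) (α : ℕ → ℕ) (h0 : ∀ l < i, α l = 0) (hG : total d α ≤ G) :
    ∃ N : ℕ, N ≤ (i + (G - total d α)).choose i ∧
      (nextIndex d G)^[N] α = carry d G (d - i) i α ∧
      ∑ t ∈ Finset.range N, f ((nextIndex d G)^[t] α) = boxSum f i (G - total d α) α ∧
      ∀ t < N, total d ((nextIndex d G)^[t] α) ≤ G ∧ ∀ l, i ≤ l → (nextIndex d G)^[t] α l = α l := by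
  induction i generalizing α with
  | zero =>
    refine ⟨1, by simp, rfl, by simp [boxSum], ?_⟩
    intro t ht
    obtain rfl : t = 0 := by omega
    exact ⟨hG, fun _ _ => rfl⟩
  | succ i ih =>
    -- Entry `i` may now be nonzero, and the induction is on the slack `r`. After a run through the
    -- first `i` entries the carry raises entry `i` and uses up one unit of slack; without slack it
    -- clears entry `i` and passes on. The counts add up by Pascal's rule.
    have key : ∀ r (α : ℕ → ℕ), (∀ l < i, α l = 0) → total d α + r = G →
        ∃ N : ℕ, N ≤ (i + 1 + r).choose (i + 1) ∧
          (nextIndex d G)^[N] α = carry d G (d - (i + 1)) (i + 1) (Function.update α i 0) ∧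
          ∑ t ∈ Finset.range N, f ((nextIndex d G)^[t] α) = boxSum f (i + 1) r α ∧
          ∀ t < N, total d ((nextIndex d G)^[t] α) ≤ G ∧
            ∀ l, i + 1 ≤ l → (nextIndex d G)^[t] α l = α l := by
      intro r
      induction r with
      | zero =>
        intro α hα hr
        obtain ⟨N, hN, hc, hs, ht⟩ := ih (by omega) α hα (by omega)
        rw [show G - total d α = 0 by omega] at hN hs
        refine ⟨N, by simpa using hN, ?_, ?_, fun t h => ⟨(ht t h).1, fun l hl => (ht t h).2 l (by omega)⟩⟩
        · rw [hc, show d - i = (d - (i + 1)) + 1 by omega, carry, if_pos]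
          rw [total_bump (by omega)]; omega
        · rw [hs]; simp [boxSum]
      | succ r ihr =>
        intro α hα hr
        obtain ⟨N, hN, hc, hs, ht⟩ := ih (by omega) α hα (by omega)
        rw [show G - total d α = r + 1 by omega] at hN hs
        have hb : total d (bump α i) = total d α + 1 := total_bump (by omega) α
        rw [show d - i = (d - (i + 1)) + 1 by omega, carry, if_neg (by omega)] at hc
        obtain ⟨N', hN', hc', hs', ht'⟩ := ihr (bump α i) (by
          intro l hl
          simp only [bump]
          rw [Function.update_of_ne (by omega)]
          exact hα l hl) (by omega)
        have hit : ∀ t, (nextIndex d G)^[N + t] α = (nextIndex d G)^[t] (bump α i) := by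
          intro t
          rw [Nat.add_comm, Function.iterate_add_apply, hc]
        refine ⟨N + N', ?_, ?_, ?_, ?_⟩
        · have : (i + 1 + (r + 1)).choose (i + 1)
              = (i + (r + 1)).choose i + (i + 1 + r).choose (i + 1) := by
            rw [show i + 1 + (r + 1) = (i + (r + 1)) + 1 by omega, Nat.choose_succ_succ,
              show i + 1 + r = i + (r + 1) by omega]
          omega
        · rw [hit, hc']
          simp [bump]
        · rw [Finset.sum_range_add, hs]
          simp only [hit]
          rw [hs', boxSum, boxSum, Finset.sum_range_succ' _ (r + 1), add_comm]
          congr 1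
          · refine Finset.sum_congr rfl fun a _ => ?_
            rw [show r + 1 - (a + 1) = r - a by omega]
            simp [bump, add_assoc, add_comm 1 a]
          · simp
        · intro t h
          by_cases h' : t < N
          · exact ⟨(ht t h').1, fun l hl => (ht t h').2 l (by omega)⟩
          · obtain ⟨u, rfl⟩ := Nat.exists_eq_add_of_le (not_lt.1 h')
            rw [hit]
            refine ⟨(ht' u (by omega)).1, fun l hl => ?_⟩
            rw [(ht' u (by omega)).2 l hl]
            simp only [bump]
            rw [Function.update_of_ne (by omega)]
    obtain ⟨N, hN, hc, hs, ht⟩ := key (G - total d α) α (fun l hl => h0 l (by omega)) (by omega)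
    refine ⟨N, hN, ?_, hs, ht⟩
    rw [hc, Function.update_eq_self_iff.2 (h0 i (by omega)).symm]

/-- The odometer started at zero runs once through the multi-indices of total at most `G`. -/
theorem exists_iterate_nextIndex_zero {M : Type*} [AddCommMonoid M] (f : (ℕ → ℕ) → M) (d G : ℕ) :
    ∃ N : ℕ, N ≤ (d + G).choose d ∧ (nextIndex d G)^[N] 0 d = 1 ∧
      ∑ t ∈ Finset.range N, f ((nextIndex d G)^[t] 0) = boxSum f d G 0 ∧
      ∀ t < N, total d ((nextIndex d G)^[t] 0) ≤ G ∧ (nextIndex d G)^[t] 0 d = 0 := by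
  have h0 : total d 0 = 0 := by simp [total]
  obtain ⟨N, hN, hc, hs, ht⟩ := exists_iterate_nextIndex f d G d le_rfl 0 (fun _ _ => rfl) (by omega)
  rw [h0] at hN hs
  refine ⟨N, hN, ?_, hs, fun t h => ⟨(ht t h).1, (ht t h).2 d le_rfl⟩⟩
  rw [hc, Nat.sub_self]
  simp [carry, bump]

/-! ### Truncated exponentials as sums over multi-indices. -/

/-- The truncated exponential series. -/
def expTrunc (r : ℕ) (x : ℝ) : ℝ := ∑ m ∈ Finset.range (r + 1), x ^ m / m.factorial

/-- Both sides sum `y ^ a / a! * (x ^ b / b!)` over `a + b ≤ r`, grouped by `a + b` on the left and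
by `a` on the right. The identity is exact because the truncation is by total degree. -/
theorem expTrunc_add (r : ℕ) (x y : ℝ) :
    expTrunc r (x + y) = ∑ a ∈ Finset.range (r + 1), y ^ a / a.factorial * expTrunc (r - a) x := by
  have h1 : ∀ m : ℕ, (x + y) ^ m / m.factorial
      = ∑ p ∈ Finset.HasAntidiagonal.antidiagonal m, y ^ p.1 / p.1.factorial * (x ^ p.2 / p.2.factorial) := by
    intro m
    rw [add_comm x y, (Commute.all y x).add_pow', Finset.sum_div]
    refine Finset.sum_congr rfl fun p hp => ?_
    rw [Finset.HasAntidiagonal.mem_antidiagonal] at hp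
    subst hp
    rw [nsmul_eq_mul, Nat.cast_add_choose]
    field_simp
  simp only [expTrunc, h1, Finset.mul_sum]
  rw [Finset.sum_sigma', Finset.sum_sigma']
  refine Finset.sum_nbij' (fun p => ⟨p.2.1, p.2.2⟩) (fun p => ⟨p.1 + p.2, (p.1, p.2)⟩) ?_ ?_ ?_ ?_ ?_
  · rintro ⟨m, a, b⟩ h
    simp at h ⊢
    omega
  · rintro ⟨a, b⟩ h
    simp at h ⊢
    omega
  · rintro ⟨m, a, b⟩ h
    simp at h
    simp [h.2]
  · rintro ⟨a, b⟩ h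
    rfl
  · rintro ⟨m, a, b⟩ h
    rfl

theorem expTrunc_zero_right (r : ℕ) : expTrunc r 0 = 1 := by
  simp [expTrunc, Finset.sum_range_succ']

/-- Summing the monomials over all multi-indices of bounded total gives a truncated exponential. -/
theorem boxSum_monomial (d : ℕ) (x : ℕ → ℝ) (i : ℕ) (hi : i ≤ d) (r : ℕ) (α : ℕ → ℕ)
    (h0 : ∀ l < i, α l = 0) :
    boxSum (fun α => ∏ l ∈ Finset.range d, x l ^ α l / (α l).factorial) i r α
      = expTrunc r (∑ l ∈ Finset.range i, x l)
        * ∏ l ∈ Finset.Ico i d, x l ^ α l / (α l).factorial := by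
  induction i generalizing r α with
  | zero => simp [boxSum, expTrunc_zero_right]
  | succ i ih =>
    rw [boxSum, Finset.sum_range_succ (fun l => x l) i, expTrunc_add, Finset.sum_mul]
    refine Finset.sum_congr rfl fun a _ => ?_
    rw [ih (by omega) _ _ (fun l hl => by
      rw [Function.update_of_ne (by omega)]; exact h0 l (by omega)),
      Finset.prod_eq_prod_Ico_succ_bot (by omega), Function.update_self, h0 i (by omega), zero_add]
    have : ∏ l ∈ Finset.Ico (i + 1) d,
          x l ^ Function.update α i a l / (Function.update α i a l).factorial
        = ∏ l ∈ Finset.Ico (i + 1) d, x l ^ α l / (α l).factorial := by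
      refine Finset.prod_congr rfl fun l hl => ?_
      rw [Finset.mem_Ico] at hl
      rw [Function.update_of_ne (by omega)]
    rw [this]
    ring

theorem boxSum_apply {ι : Type*} (f : (ℕ → ℕ) → ι → ℝ) (i r : ℕ) (α : ℕ → ℕ) (m : ι) :
    boxSum f i r α m = boxSum (fun α => f α m) i r α := by
  induction i generalizing r α with
  | zero => rfl
  | succ i ih => simp [boxSum, Finset.sum_apply, ih]

theorem boxSum_sum {ι : Type*} (s : Finset ι) (f : ι → (ℕ → ℕ) → ℝ) (c : ι → ℝ) (i r : ℕ)
    (α : ℕ → ℕ) :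
    boxSum (fun α => ∑ k ∈ s, c k * f k α) i r α = ∑ k ∈ s, c k * boxSum (f k) i r α := by
  induction i generalizing r α with
  | zero => rfl
  | succ i ih =>
    simp only [boxSum, ih, Finset.mul_sum]
    exact Finset.sum_comm

/-! ### Symbolic execution of instructions. -/

namespace RInstr

theorem act_iconst (a k : ℕ) (s : Store) :
    (iconst a k).act s = { s with ireg := Function.update s.ireg a k } := rfl

theorem act_iadd (a b c : ℕ) (s : Store) :
    (iadd a b c).act s = { s with ireg := Function.update s.ireg a (s.ireg b + s.ireg c) } := rfl

theorem act_isub (a b c : ℕ) (s : Store) :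
    (isub a b c).act s = { s with ireg := Function.update s.ireg a (s.ireg b - s.ireg c) } := rfl

theorem act_iload (a b : ℕ) (s : Store) :
    (iload a b).act s = { s with ireg := Function.update s.ireg a (s.imem (s.ireg b)) } := rfl

theorem act_istore (a b : ℕ) (s : Store) :
    (istore a b).act s = { s with imem := Function.update s.imem (s.ireg a) (s.ireg b) } := rfl

theorem act_fcast (a b : ℕ) (s : Store) :
    (fcast a b).act s = { s with freg := Function.update s.freg a ((s.ireg b : ℕ) : ℝ) } := rfl

theorem act_fadd (a b c : ℕ) (s : Store) :
    (fadd a b c).act s = { s with freg := Function.update s.freg a (s.freg b + s.freg c) } := rfl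

theorem act_fsub (a b c : ℕ) (s : Store) :
    (fsub a b c).act s = { s with freg := Function.update s.freg a (s.freg b - s.freg c) } := rfl

theorem act_fmul (a b c : ℕ) (s : Store) :
    (fmul a b c).act s = { s with freg := Function.update s.freg a (s.freg b * s.freg c) } := rfl

theorem act_fdiv (a b c : ℕ) (s : Store) :
    (fdiv a b c).act s = { s with freg := Function.update s.freg a (s.freg b / s.freg c) } := rfl

theorem act_fload (a b : ℕ) (s : Store) :
    (fload a b).act s = { s with freg := Function.update s.freg a (s.fmem (s.ireg b)) } := rfl

theorem act_fstore (a b : ℕ) (s : Store) :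
    (fstore a b).act s = { s with fmem := Function.update s.fmem (s.ireg a) (s.freg b) } := rfl

end RInstr

attribute [simp] acts_nil acts_cons RInstr.act_iconst RInstr.act_iadd RInstr.act_isub
  RInstr.act_iload RInstr.act_istore RInstr.act_fcast RInstr.act_fadd RInstr.act_fsub
  RInstr.act_fmul RInstr.act_fdiv RInstr.act_fload RInstr.act_fstore

/-! ### Register discipline: inner commands write only to registers with higher numbers. -/

/-- Integer registers below `a` and real registers below `b` agree, and so do the integer memories. -/
structure Frame (a b : ℕ) (s s' : Store) : Prop where
  imem : s'.imem = s.imem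
  ireg : ∀ r < a, s'.ireg r = s.ireg r
  freg : ∀ r < b, s'.freg r = s.freg r

theorem Frame.refl (a b : ℕ) (s : Store) : Frame a b s s := ⟨rfl, fun _ _ => rfl, fun _ _ => rfl⟩

theorem Frame.trans {a b : ℕ} {s s' s'' : Store} (h : Frame a b s s') (h' : Frame a b s' s'') :
    Frame a b s s'' :=
  ⟨h'.imem.trans h.imem, fun r hr => (h'.ireg r hr).trans (h.ireg r hr),
    fun r hr => (h'.freg r hr).trans (h.freg r hr)⟩

theorem Frame.mono {a b a' b' : ℕ} {s s' : Store} (h : Frame a b s s') (ha : a' ≤ a) (hb : b' ≤ b) :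
    Frame a' b' s s' :=
  ⟨h.imem, fun r hr => h.ireg r (hr.trans_le ha), fun r hr => h.freg r (hr.trans_le hb)⟩

theorem Frame.update {a b : ℕ} {s s' : Store} (h : Frame a b s s') {r : ℕ} (hr : a ≤ r) (v : ℕ) :
    Frame a b s { s' with ireg := Function.update s'.ireg r v } :=
  ⟨h.imem, fun q hq => by
    change Function.update s'.ireg r v q = _
    rw [Function.update_of_ne (by omega)]; exact h.ireg q hq, h.freg⟩

open Cmd

/-! ### Monomials -/

/-- Multiplies, for `l < d` and `a < imem l`, real register `20` according to `ops`, with the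
entry at address `ireg 22 + l` in real register `21` and `a` in integer register `33`. -/
def colProd (ops : List RInstr) : Cmd :=
  -- Integer registers `6` and `7` hold zero and one: the product starts at one, and the addition
  -- merely copies an address.
  block [.fcast 20 7, .iadd 31 22 6] ;;
  loop 30 2 (block [.iload 32 30, .fload 21 31] ;; loop 33 32 (block ops) ;; block [.iadd 31 31 7])

/-- `ops` multiplies real register `20` by `w (freg 0) (freg 21) (ireg 33)`. -/
structure Multiplies (ops : List RInstr) (w : ℝ → ℝ → ℕ → ℝ) : Prop where
  isOp : ops.all RInstr.isOp = true
  length : ops.length ≤ 5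
  frame : ∀ s, Frame 34 20 s (acts ops s)
  fmem : ∀ s, (acts ops s).fmem = s.fmem
  freg : ∀ s, (acts ops s).freg 21 = s.freg 21
  eq : ∀ s, s.ireg 7 = 1 →
    (acts ops s).freg 20 = s.freg 20 * w (s.freg 0) (s.freg 21) (s.ireg 33)

theorem wp_colProd {ops : List RInstr} {w : ℝ → ℝ → ℕ → ℝ} (hw : Multiplies ops w) {d G p : ℕ}
    {s : Store} (h2 : s.ireg 2 = d) (h6 : s.ireg 6 = 0) (h7 : s.ireg 7 = 1) (hp : s.ireg 22 = p)
    (hG : ∀ l < d, s.imem l ≤ G) :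
    (colProd ops).Wp (d * (8 * G + 9) + 5) (fun s' => Frame 30 20 s s' ∧ s'.fmem = s.fmem ∧
      s'.freg 20 = ∏ l ∈ Finset.range d, ∏ a ∈ Finset.range (s.imem l),
        w (s.freg 0) (s.fmem (p + l)) a) s := by
  refine wp_block_seq rfl (t := d * (8 * G + 9) + 3) ?_ (by simp; omega)
  refine wp_loop (N := d) (tb := 8 * G + 6) (fun k s' => Frame 30 20 s s' ∧ s'.fmem = s.fmem ∧
    s'.ireg 31 = p + k ∧ s'.freg 20 = ∏ l ∈ Finset.range k, ∏ a ∈ Finset.range (s.imem l),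
        w (s.freg 0) (s.fmem (p + l)) a) ?_ ?_ ?_ ?_ ?_ le_rfl
  · rintro k s' v ⟨h, hf, h31, h20⟩
    exact ⟨h.update le_rfl v, hf, by simpa using h31, h20⟩
  · refine ⟨⟨?_, ?_, ?_⟩, ?_, ?_, ?_⟩
    · simp
    · intro r hr
      simp (disch := omega) [Function.update_of_ne]
    · intro r hr
      simp (disch := omega) [Function.update_of_ne]
    · simp
    · simp [hp, h6]
    · simp [h7]
  · rintro k s' ⟨h, -, -, -⟩
    exact ⟨(h.ireg 2 (by norm_num)).trans h2, (h.ireg 7 (by norm_num)).trans h7⟩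
  · rintro k hk s' ⟨h, hf, h31, h20⟩ h30
    refine wp_block_seq rfl (t := 8 * G + 4) ?_ (by simp; omega)
    refine Wp.seq (t₁ := 8 * G + 3) (t₂ := 1) (R := fun s'' => Frame 30 20 s s'' ∧
      s''.fmem = s.fmem ∧ s''.ireg 31 = p + k ∧ s''.ireg 30 = k ∧
      s''.freg 20 = ∏ l ∈ Finset.range (k + 1), ∏ a ∈ Finset.range (s.imem l),
        w (s.freg 0) (s.fmem (p + l)) a) ?_ ?_ le_rfl
    · have hk' := hG k hk
      refine wp_loop (N := s.imem k) (tb := 5) (fun m s'' => Frame 30 20 s s'' ∧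
        s''.fmem = s.fmem ∧ s''.ireg 31 = p + k ∧ s''.ireg 30 = k ∧ s''.ireg 32 = s.imem k ∧
        s''.freg 21 = s.fmem (p + k) ∧
        s''.freg 20 = (∏ l ∈ Finset.range k, ∏ a ∈ Finset.range (s.imem l),
          w (s.freg 0) (s.fmem (p + l)) a) * ∏ a ∈ Finset.range m,
            w (s.freg 0) (s.fmem (p + k)) a) ?_ ?_ ?_ ?_ ?_ (by omega)
      · rintro m s'' v ⟨h, hf, h31, h30, h32, h21, h20⟩
        exact ⟨h.update (by norm_num) v, hf, by simpa using h31, by simpa using h30,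
          by simpa using h32, h21, h20⟩
      · refine ⟨h.trans ⟨?_, ?_, ?_⟩, ?_, ?_, ?_, ?_, ?_, ?_⟩
        · simp
        · intro r hr
          simp (disch := omega) [Function.update_of_ne]
        · intro r hr
          simp (disch := omega) [Function.update_of_ne]
        · simpa using hf
        · simpa using h31
        · simpa using h30
        · simp [h30, h.imem]
        · simp [h31, hf]
        · simpa using h20
      · rintro m s'' ⟨h, hf, h31, h30, h32, h21, h20⟩
        exact ⟨h32, (h.ireg 7 (by norm_num)).trans h7⟩
      · rintro m hm s'' ⟨h, hf, h31, h30, h32, h21, h20⟩ h33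
        have fr := hw.frame s''
        refine wp_block hw.isOp hw.length ⟨⟨h.trans (fr.mono (by norm_num) le_rfl), ?_, ?_, ?_, ?_, ?_, ?_⟩, ?_⟩
        · rw [hw.fmem, hf]
        · rw [fr.ireg 31 (by norm_num), h31]
        · rw [fr.ireg 30 (by norm_num), h30]
        · rw [fr.ireg 32 (by norm_num), h32]
        · rw [hw.freg, h21]
        · rw [hw.eq s'' ((h.ireg 7 (by norm_num)).trans h7), h20, h21, h33,
            h.freg 0 (by norm_num), Finset.prod_range_succ _ m, mul_assoc]
        · rw [fr.ireg 33 (by norm_num), h33]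
      · rintro s'' ⟨h, hf, h31, h30, h32, h21, h20⟩
        exact ⟨h, hf, h31, h30, by rw [h20, Finset.prod_range_succ _ k]⟩
    · rintro s'' ⟨h, hf, h31, h30, h20⟩
      refine wp_block rfl le_rfl ⟨⟨h.trans ⟨?_, ?_, ?_⟩, ?_, ?_, ?_⟩, ?_⟩
      · simp
      · intro r hr
        simp (disch := omega) [Function.update_of_ne]
      · intro r hr
        simp
      · simpa using hf
      · simp [h31, h.ireg 7 (by norm_num), h7, add_assoc]
      · simpa using h20
      · simpa using h30
  · rintro s' ⟨h, hf, h31, h20⟩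
    exact ⟨h, hf, h20⟩

/-- Multiplication by the entry. -/
def opsK : List RInstr := [.fmul 20 20 21]

/-- Multiplication by `β` times the entry, divided by `a + 1`. -/
def opsQ : List RInstr :=
  [.fmul 20 20 21, .fmul 20 20 0, .iadd 34 33 7, .fcast 22 34, .fdiv 20 20 22]

theorem multiplies_opsK : Multiplies opsK fun _ x _ => x := by
  refine ⟨rfl, by simp [opsK], fun s => ⟨?_, ?_, ?_⟩, ?_, ?_, ?_⟩
  · simp [opsK]
  · simp [opsK]
  · intro r hr
    simp (disch := omega) [opsK, Function.update_of_ne]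
  · simp [opsK]
  · simp [opsK]
  · simp [opsK]

/-- The divisors `a + 1` for `a < α l` multiply to `(α l)!`, so the whole multinomial weight is
supplied on the side of `Q`. -/
theorem multiplies_opsQ : Multiplies opsQ fun β x a => x * β / ((a + 1 : ℕ) : ℝ) := by
  refine ⟨rfl, by simp [opsQ], fun s => ⟨?_, ?_, ?_⟩, ?_, ?_, ?_⟩
  · simp [opsQ]
  · intro r hr
    simp (disch := omega) [opsQ, Function.update_of_ne]
  · intro r hr
    simp (disch := omega) [opsQ, Function.update_of_ne]
  · simp [opsQ]
  · simp [opsQ]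
  · intro s hs
    simp [opsQ, hs]
    ring

/-! ### The contribution of one multi-index -/

/-- The monomial of a column of `K`. -/
def phi (m : ℕ → ℝ) (d D : ℕ) (α : ℕ → ℕ) (k : ℕ) : ℝ :=
  ∏ l ∈ Finset.range d, ∏ _a ∈ Finset.range (α l), m (D + d * k + l)

/-- The weighted monomial of a column of `Q`. -/
def psi (m : ℕ → ℝ) (β : ℝ) (d : ℕ) (α : ℕ → ℕ) (j : ℕ) : ℝ :=
  ∏ l ∈ Finset.range d, ∏ a ∈ Finset.range (α l), m (d * j + l) * β / ((a + 1 : ℕ) : ℝ)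

/-- The memory change that adds `v₁ * x j` and `v₀ * x j` to the accumulators of row `i`. -/
def scatter (d D i : ℕ) (x : ℕ → ℝ) (v₁ v₀ : ℝ) (N : ℕ) : ℕ → ℝ :=
  ∑ j ∈ Finset.range N, (Pi.single (3 * D + (d * j + i)) (x j * v₁)
    + Pi.single (4 * D + (d * j + i)) (x j * v₀))

/-- The memory change caused by one multi-index in the first `N` rows. -/
def contribution (m : ℕ → ℝ) (β : ℝ) (d n D N : ℕ) (α : ℕ → ℕ) : ℕ → ℝ :=
  ∑ i ∈ Finset.range N, scatter d D i (psi m β d α)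
    (∑ k ∈ Finset.range n, phi m d D α k * m (2 * D + d * k + i))
    (∑ k ∈ Finset.range n, phi m d D α k) n

theorem mul_add_lt_mul {d n i j : ℕ} (hi : i < d) (hj : j < n) : d * j + i < d * n :=
  calc d * j + i < d * j + d := by omega
    _ = d * (j + 1) := by ring
    _ ≤ d * n := Nat.mul_le_mul_left d hj

/-- The accumulators lie above the three input matrices, so the input stays readable during the
enumeration. -/
theorem scatter_of_lt {d D i N m : ℕ} {x : ℕ → ℝ} {v₁ v₀ : ℝ} (hm : m < 3 * D) :
    scatter d D i x v₁ v₀ N m = 0 := by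
  rw [scatter, Finset.sum_apply]
  refine Finset.sum_eq_zero fun j _ => ?_
  rw [Pi.add_apply, Pi.single_eq_of_ne (by omega), Pi.single_eq_of_ne (by omega), add_zero]

theorem contribution_of_lt {m : ℕ → ℝ} {β : ℝ} {d n D N : ℕ} {α : ℕ → ℕ} {a : ℕ} (ha : a < 3 * D) :
    contribution m β d n D N α a = 0 := by
  rw [contribution, Finset.sum_apply]
  exact Finset.sum_eq_zero fun i _ => scatter_of_lt ha

/-- Turns an accumulation in place into an addition of functions; the effect of the whole
enumeration then becomes a sum in `ℕ → ℝ`. -/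
theorem update_add_eq_add_single (f : ℕ → ℝ) (a : ℕ) (v : ℝ) :
    Function.update f a (f a + v) = f + Pi.single a v := by
  ext b
  by_cases h : b = a
  · subst h; simp
  · simp [h]

/-- Computes the sums over the columns of `K` and `V` for row `ireg 20`. -/
def sumsCmd : Cmd :=
  block [.fsub 10 1 1, .fsub 11 1 1, .iadd 22 4 6] ;;
  loop 21 3 (colProd opsK ;; block [.iadd 23 22 4, .iadd 23 23 20, .fload 12 23, .fmul 12 12 20,
    .fadd 10 10 12, .fadd 11 11 20, .iadd 22 22 2])

/-- Adds the sums, weighted by the monomials of the columns of `Q`, to the accumulators of row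
`ireg 20`. -/
def scatterCmd : Cmd :=
  block [.iconst 22 0] ;;
  loop 21 3 (colProd opsQ ;; block [.iadd 23 22 12, .iadd 23 23 20, .fload 12 23, .fmul 13 20 10,
    .fadd 12 12 13, .fstore 23 12, .iadd 23 23 4, .fload 12 23, .fmul 13 20 11, .fadd 12 12 13,
    .fstore 23 12, .iadd 22 22 2])

/-- Adds the contribution of the multi-index in the integer memory. -/
def contributeCmd : Cmd := loop 20 2 (sumsCmd ;; scatterCmd)

/-- The constant registers. -/
structure Consts (d n D : ℕ) (β : ℝ) (s : Store) : Prop where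
  r2 : s.ireg 2 = d
  r3 : s.ireg 3 = n
  r4 : s.ireg 4 = D
  r6 : s.ireg 6 = 0
  r7 : s.ireg 7 = 1
  r12 : s.ireg 12 = 3 * D
  f0 : s.freg 0 = β
  f1 : s.freg 1 = 0

theorem Consts.of_frame {d n D : ℕ} {β : ℝ} {s s' : Store} (h : Consts d n D β s) {a b : ℕ}
    (ha : 13 ≤ a) (hb : 2 ≤ b) (hf : Frame a b s s') : Consts d n D β s' :=
  ⟨(hf.ireg 2 (by omega)).trans h.r2, (hf.ireg 3 (by omega)).trans h.r3,
    (hf.ireg 4 (by omega)).trans h.r4, (hf.ireg 6 (by omega)).trans h.r6,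
    (hf.ireg 7 (by omega)).trans h.r7, (hf.ireg 12 (by omega)).trans h.r12,
    (hf.freg 0 (by omega)).trans h.f0, (hf.freg 1 (by omega)).trans h.f1⟩

/-- The memory is compared with the fixed input `m` only below `3 * D`, since the accumulators above
change from one multi-index to the next. -/
theorem wp_sumsCmd {d n D G i : ℕ} {β : ℝ} {α : ℕ → ℕ} {m : ℕ → ℝ} {s : Store}
    (hc : Consts d n D β s) (hD : D = d * n) (hα : s.imem = α) (hG : ∀ l < d, α l ≤ G)
    (hm : ∀ a < 3 * D, s.fmem a = m a) (h20 : s.ireg 20 = i) (hi : i < d) :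
    sumsCmd.Wp (n * (d * (8 * G + 9) + 15) + 6) (fun s' => Frame 21 10 s s' ∧ s'.fmem = s.fmem ∧
      s'.freg 10 = ∑ k ∈ Finset.range n, phi m d D α k * m (2 * D + d * k + i) ∧
      s'.freg 11 = ∑ k ∈ Finset.range n, phi m d D α k) s := by
  refine wp_block_seq rfl (t := n * (d * (8 * G + 9) + 15) + 3) ?_ (by simp; omega)
  refine wp_loop (N := n) (tb := d * (8 * G + 9) + 12) (fun k s' => Frame 21 10 s s' ∧
    s'.fmem = s.fmem ∧ s'.ireg 22 = D + d * k ∧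
    s'.freg 10 = ∑ k ∈ Finset.range k, phi m d D α k * m (2 * D + d * k + i) ∧
      s'.freg 11 = ∑ k ∈ Finset.range k, phi m d D α k) ?_ ?_ ?_ ?_ ?_ le_rfl
  · rintro k s' v ⟨h, hf, h22, h10⟩
    exact ⟨h.update le_rfl v, hf, by simpa using h22, h10⟩
  · refine ⟨⟨?_, ?_, ?_⟩, ?_, ?_, ?_, ?_⟩
    · simp
    · intro r hr
      simp (disch := omega) [Function.update_of_ne]
    · intro r hr
      simp (disch := omega) [Function.update_of_ne]
    · simp
    · simp [hc.r4, hc.r6]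
    · simp
    · simp
  · rintro k s' ⟨h, -⟩
    have := hc.of_frame (by norm_num) (by norm_num) h
    exact ⟨this.r3, this.r7⟩
  · rintro k hk s' ⟨h, hf, h22, h10, h11⟩ h21
    have hc' := hc.of_frame (by norm_num) (by norm_num) h
    have him : s'.imem = α := h.imem.trans hα
    refine Wp.seq (wp_colProd multiplies_opsK hc'.r2 hc'.r6 hc'.r7 h22
      (fun l hl => by rw [him]; exact hG l hl)) ?_ (t₂ := 7) (by omega)
    rintro s'' ⟨fr, hf', hp⟩
    have hphi : s''.freg 20 = phi m d D α k := by
      rw [hp, phi, him]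
      refine Finset.prod_congr rfl fun l hl => Finset.prod_congr rfl fun a _ => ?_
      have := mul_add_lt_mul (Finset.mem_range.1 hl) hk
      rw [hf]
      exact hm _ (by omega)
    have hV : s''.fmem (D + d * k + D + i) = m (2 * D + d * k + i) := by
      have := mul_add_lt_mul hi hk
      rw [hf', hf, show D + d * k + D + i = 2 * D + d * k + i by ring]
      exact hm _ (by omega)
    refine wp_block rfl le_rfl ⟨⟨(h.trans (fr.mono (by norm_num) (by norm_num))).trans ⟨?_, ?_, ?_⟩,
      ?_, ?_, ?_, ?_⟩, ?_⟩
    · simp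
    · intro r hr
      simp (disch := omega) [Function.update_of_ne]
    · intro r hr
      simp (disch := omega) [Function.update_of_ne]
    · simpa using hf'.trans hf
    · simp [fr.ireg 22 (by norm_num), h22, fr.ireg 2 (by norm_num), hc'.r2]
      ring
    · simp only [acts_cons, acts_nil, RInstr.act_iadd, RInstr.act_fload, RInstr.act_fmul,
        RInstr.act_fadd]
      simp [fr.ireg 22 (by norm_num), h22, fr.ireg 4 (by norm_num), hc'.r4, fr.ireg 20 (by norm_num),
        h.ireg 20 (by norm_num), h20, hV, hphi, fr.freg 10 (by norm_num), h10,
        Finset.sum_range_succ _ k, mul_comm]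
    · simp [fr.freg 11 (by norm_num), h11, hphi, Finset.sum_range_succ _ k]
    · simp [fr.ireg 21 (by norm_num), h21]
  · rintro s' ⟨h, hf, h22, h10, h11⟩
    exact ⟨h, hf, h10, h11⟩

theorem wp_scatterCmd {d n D G i : ℕ} {β v₁ v₀ : ℝ} {α : ℕ → ℕ} {m : ℕ → ℝ} {s : Store}
    (hc : Consts d n D β s) (hD : D = d * n) (hα : s.imem = α) (hG : ∀ l < d, α l ≤ G)
    (hm : ∀ a < 3 * D, s.fmem a = m a) (h20 : s.ireg 20 = i)
    (h10 : s.freg 10 = v₁) (h11 : s.freg 11 = v₀) :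
    scatterCmd.Wp (n * (d * (8 * G + 9) + 20) + 4) (fun s' => Frame 21 10 s s' ∧
      s'.fmem = s.fmem + scatter d D i (psi m β d α) v₁ v₀ n) s := by
  refine wp_block_seq rfl (t := n * (d * (8 * G + 9) + 20) + 3) ?_ (by simp; omega)
  refine wp_loop (N := n) (tb := d * (8 * G + 9) + 17) (fun k s' => Frame 21 12 s s' ∧
    s'.ireg 22 = d * k ∧ s'.fmem = s.fmem + scatter d D i (psi m β d α) v₁ v₀ k)
    ?_ ?_ ?_ ?_ ?_ le_rfl
  · rintro k s' v ⟨h, h22, hf⟩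
    exact ⟨h.update le_rfl v, by simpa using h22, hf⟩
  · refine ⟨⟨?_, ?_, ?_⟩, ?_, ?_⟩
    · simp
    · intro r hr
      simp (disch := omega) [Function.update_of_ne]
    · intro r hr
      simp
    · simp
    · simp [scatter]
  · rintro k s' ⟨h, -⟩
    have := hc.of_frame (by norm_num) (by norm_num) h
    exact ⟨this.r3, this.r7⟩
  · rintro k hk s' ⟨h, h22, hf⟩ h21
    have hc' := hc.of_frame (by norm_num) (by norm_num) h
    have him : s'.imem = α := h.imem.trans hα
    refine Wp.seq (wp_colProd multiplies_opsQ hc'.r2 hc'.r6 hc'.r7 h22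
      (fun l hl => by rw [him]; exact hG l hl)) ?_ (t₂ := 12) (by omega)
    rintro s'' ⟨fr, hf', hp⟩
    have hpsi : s''.freg 20 = psi m β d α k := by
      rw [hp, psi, him]
      refine Finset.prod_congr rfl fun l hl => Finset.prod_congr rfl fun a _ => ?_
      have := mul_add_lt_mul (Finset.mem_range.1 hl) hk
      rw [hf, Pi.add_apply, scatter_of_lt (by omega), add_zero, hm _ (by omega), hc'.f0]
    have e : (acts [.iadd 23 22 12, .iadd 23 23 20, .fload 12 23, .fmul 13 20 10, .fadd 12 12 13,
        .fstore 23 12, .iadd 23 23 4, .fload 12 23, .fmul 13 20 11, .fadd 12 12 13,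
        .fstore 23 12, .iadd 22 22 2] s'').fmem
        = s''.fmem + Pi.single (3 * D + (d * k + i)) (psi m β d α k * v₁)
          + Pi.single (4 * D + (d * k + i)) (psi m β d α k * v₀) := by
      rw [← update_add_eq_add_single, ← update_add_eq_add_single]
      simp [fr.ireg 22 (by norm_num), h22, fr.ireg 4 (by norm_num), hc'.r4, fr.ireg 20 (by norm_num),
        h.ireg 20 (by norm_num), h20, hpsi, fr.ireg 12 (by norm_num), hc'.r12,
        fr.freg 10 (by norm_num), h.freg 10 (by norm_num), h10,
        fr.freg 11 (by norm_num), h.freg 11 (by norm_num), h11,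
        show d * k + 3 * D + i = 3 * D + (d * k + i) by ring,
        show 3 * D + (d * k + i) + D = 4 * D + (d * k + i) by ring]
    refine wp_block rfl le_rfl ⟨⟨(h.trans (fr.mono (by norm_num) (by norm_num))).trans ⟨?_, ?_, ?_⟩,
      ?_, ?_⟩, ?_⟩
    · simp
    · intro r hr
      simp (disch := omega) [Function.update_of_ne]
    · intro r hr
      simp (disch := omega) [Function.update_of_ne]
    · simp [fr.ireg 22 (by norm_num), h22, fr.ireg 2 (by norm_num), hc'.r2]
      ring
    · rw [e, hf', hf, scatter, scatter, Finset.sum_range_succ, add_assoc, add_assoc]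
    · simp [fr.ireg 21 (by norm_num), h21]
  · rintro s' ⟨h, h22, hf⟩
    exact ⟨h.mono le_rfl (by norm_num), hf⟩

theorem wp_contributeCmd {d n D G : ℕ} {β : ℝ} {α : ℕ → ℕ} {m : ℕ → ℝ} {s : Store}
    (hc : Consts d n D β s) (hD : D = d * n) (hα : s.imem = α) (hG : ∀ l < d, α l ≤ G)
    (hm : ∀ a < 3 * D, s.fmem a = m a) :
    contributeCmd.Wp (d * (n * (2 * (d * (8 * G + 9)) + 35) + 13) + 3) (fun s' => Frame 20 10 s s' ∧
      s'.fmem = s.fmem + contribution m β d n D d α) s := by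
  refine wp_loop (N := d) (tb := n * (2 * (d * (8 * G + 9)) + 35) + 10) (fun k s' => Frame 20 10 s s' ∧
    s'.fmem = s.fmem + contribution m β d n D k α) ?_ ?_ ?_ ?_ ?_ le_rfl
  · rintro k s' v ⟨h, hf⟩
    exact ⟨h.update le_rfl v, hf⟩
  · exact ⟨Frame.refl _ _ _, by simp [contribution]⟩
  · rintro k s' ⟨h, -⟩
    have := hc.of_frame (by norm_num) (by norm_num) h
    exact ⟨this.r2, this.r7⟩
  · rintro k hk s' ⟨h, hf⟩ h20
    have hc' := hc.of_frame (by norm_num) (by norm_num) h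
    have him : s'.imem = α := h.imem.trans hα
    have hm' : ∀ a < 3 * D, s'.fmem a = m a := fun a ha => by
      rw [hf, Pi.add_apply, contribution_of_lt ha, add_zero, hm a ha]
    refine Wp.seq (wp_sumsCmd hc' hD him hG hm' h20 hk) ?_
      (t₂ := n * (d * (8 * G + 9) + 20) + 4) (le_of_eq (by ring))
    rintro s'' ⟨fr, hf', h10, h11⟩
    refine (wp_scatterCmd (hc'.of_frame (by norm_num) (by norm_num) fr) hD (fr.imem.trans him) hG
      (fun a ha => by rw [hf', hm' a ha]) ((fr.ireg 20 (by norm_num)).trans h20) h10 h11).mono le_rfl ?_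
    rintro s₃ ⟨fr', hf₃⟩
    refine ⟨⟨h.trans ((fr.trans fr').mono (by norm_num) le_rfl), ?_⟩, ?_⟩
    · rw [hf₃, hf', hf, contribution, contribution, Finset.sum_range_succ, add_assoc]
    · rw [fr'.ireg 20 (by norm_num), fr.ireg 20 (by norm_num), h20]
  · rintro s' ⟨h, hf⟩
    exact ⟨h, hf⟩

/-! ### The enumeration -/

/-- The loop that carries in the odometer. -/
def carryCmd : Cmd :=
  iwhile 5 8 (block [.iload 16 10, .isub 8 8 16, .istore 10 6, .iadd 10 10 7, .iload 16 10,
    .iadd 16 16 7, .istore 10 16, .iadd 8 8 7])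

/-- Advances the multi-index in the integer memory. -/
def advanceCmd : Cmd :=
  block [.iconst 10 0, .iload 16 10, .iadd 16 16 7, .istore 10 16, .iadd 8 8 7] ;; carryCmd ;;
  block [.iload 9 2]

/-- The effect of the odometer commands outside the integer memory. -/
structure OdoFrame (s s' : Store) : Prop where
  ireg : ∀ r, r ≠ 8 → r ≠ 9 → r ≠ 10 → r ≠ 16 → s'.ireg r = s.ireg r
  freg : s'.freg = s.freg
  fmem : s'.fmem = s.fmem

theorem OdoFrame.trans {s s' s'' : Store} (h : OdoFrame s s') (h' : OdoFrame s' s'') :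
    OdoFrame s s'' :=
  ⟨fun r h1 h2 h3 h4 => (h'.ireg r h1 h2 h3 h4).trans (h.ireg r h1 h2 h3 h4),
    h'.freg.trans h.freg, h'.fmem.trans h.fmem⟩

theorem OdoFrame.consts {d n D : ℕ} {β : ℝ} {s s' : Store} (hf : OdoFrame s s')
    (h : Consts d n D β s) : Consts d n D β s' :=
  ⟨(hf.ireg 2 (by omega) (by omega) (by omega) (by omega)).trans h.r2,
    (hf.ireg 3 (by omega) (by omega) (by omega) (by omega)).trans h.r3,
    (hf.ireg 4 (by omega) (by omega) (by omega) (by omega)).trans h.r4,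
    (hf.ireg 6 (by omega) (by omega) (by omega) (by omega)).trans h.r6,
    (hf.ireg 7 (by omega) (by omega) (by omega) (by omega)).trans h.r7,
    (hf.ireg 12 (by omega) (by omega) (by omega) (by omega)).trans h.r12,
    by rw [hf.freg, h.f0], by rw [hf.freg, h.f1]⟩

theorem wp_carryCmd {d G : ℕ} (hG : 1 ≤ G) (fuel : ℕ) {i : ℕ} {α : ℕ → ℕ} {s : Store}
    (hi : i + fuel = d) (h0 : ∀ l < i, α l = 0) (hd : α d = 0) (ht : total d α ≤ G)
    (h5 : s.ireg 5 = G) (h6 : s.ireg 6 = 0) (h7 : s.ireg 7 = 1) (hm : s.imem = bump α i)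
    (h10 : s.ireg 10 = i) (h8 : s.ireg 8 = total d (bump α i)) :
    carryCmd.Wp (fuel * 10 + 2) (fun s' => OdoFrame s s' ∧ s'.imem = carry d G fuel i α ∧
      s'.ireg 8 = total d (carry d G fuel i α)) s := by
  induction fuel generalizing i α s with
  | zero =>
    obtain rfl : i = d := by omega
    -- When the carry reaches the overflow cell `d`, every other cell has been cleared, so the new
    -- total is `1 ≤ G` and the loop stops. Hence the machine needs no counter for the fuel.
    have : total i α = 0 := by
      rw [total, Finset.sum_range_succ, hd, add_zero]
      exact Finset.sum_eq_zero fun l hl => h0 l (Finset.mem_range.1 hl)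
    have hb := total_bump (le_refl i) α
    exact wp_iwhile_done (by omega) (by omega) ⟨⟨fun _ _ _ _ _ => rfl, rfl, rfl⟩, hm, h8⟩
  | succ fuel ih =>
    have hid : i < d := by omega
    have hb := total_bump hid.le α
    by_cases hlt : G < total d (bump α i)
    · simp only [carry, if_pos hlt]
      have hu := total_update hid.le α 0
      have hb' := total_bump (show i + 1 ≤ d by omega) (Function.update α i 0)
      have hbi : bump α i i = α i + 1 := by simp [bump]
      have hbs : bump α i (i + 1) = α (i + 1) := by simp [bump]
      refine wp_iwhile_step (t₁ := 8) (t₂ := fuel * 10 + 2) (by rw [h5, h8]; exact hlt)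
        (wp_block (Q := fun s' => s' = acts _ s) rfl le_rfl rfl) ?_ (by omega)
      rintro s' rfl
      have hf : OdoFrame s (acts [.iload 16 10, .isub 8 8 16, .istore 10 6, .iadd 10 10 7,
          .iload 16 10, .iadd 16 16 7, .istore 10 16, .iadd 8 8 7] s) := by
        refine ⟨fun r h1 h2 h3 h4 => ?_, by simp, by simp⟩
        simp [h1, h3, h4]
      refine (ih (i := i + 1) (α := Function.update α i 0) (by omega) ?_ ?_ (by omega) ?_ ?_ ?_ ?_ ?_
        ?_).mono le_rfl ?_
      · intro l hl
        by_cases h : l = i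
        · simp [h]
        · rw [Function.update_of_ne h]; exact h0 l (by omega)
      · rw [Function.update_of_ne (by omega)]; exact hd
      · simpa using h5
      · simpa using h6
      · simpa using h7
      · simp [h10, h6, h7, hm, hbs]
        simp [bump]
      · simp [h10, h7]
      · simp [h8, h10, h7, hm, hbi]
        omega
      · rintro s' ⟨hf', h⟩
        exact ⟨hf.trans hf', h⟩
    · simp only [carry, if_neg hlt]
      exact wp_iwhile_done (by omega) (by omega) ⟨⟨fun _ _ _ _ _ => rfl, rfl, rfl⟩, hm, h8⟩

theorem wp_advanceCmd {d G : ℕ} (hG : 1 ≤ G) {α : ℕ → ℕ} {s : Store} (hd : α d = 0)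
    (ht : total d α ≤ G) (h2 : s.ireg 2 = d) (h5 : s.ireg 5 = G) (h6 : s.ireg 6 = 0)
    (h7 : s.ireg 7 = 1) (hm : s.imem = α) (h8 : s.ireg 8 = total d α) :
    advanceCmd.Wp (d * 10 + 8) (fun s' => OdoFrame s s' ∧ s'.imem = nextIndex d G α ∧
      s'.ireg 8 = total d (nextIndex d G α) ∧ s'.ireg 9 = nextIndex d G α d) s := by
  refine wp_block_seq rfl (t := d * 10 + 3) ?_ (by simp; omega)
  have hf : OdoFrame s (acts [.iconst 10 0, .iload 16 10, .iadd 16 16 7, .istore 10 16,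
      .iadd 8 8 7] s) := by
    refine ⟨fun r h1 h2 h3 h4 => ?_, by simp, by simp⟩
    simp [h1, h3, h4]
  refine Wp.seq (wp_carryCmd hG d (i := 0) (α := α) (by omega) (by omega) hd ht ?_ ?_ ?_ ?_ ?_ ?_)
    ?_ (t₂ := 1) le_rfl
  · simpa using h5
  · simpa using h6
  · simpa using h7
  · simp [hm, h7, bump]
  · simp
  · rw [total_bump (Nat.zero_le d)]
    simp [h8, h7]
  · rintro s' ⟨hf', hm', h8'⟩
    have hff := hf.trans hf'
    refine wp_block rfl le_rfl ⟨hff.trans ⟨fun r h1 h2 h3 h4 => ?_, by simp, by simp⟩, ?_, ?_, ?_⟩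
    · simp [h2]
    · simpa [nextIndex] using hm'
    · simpa [nextIndex] using h8'
    · simp [hff.ireg 2, h2, hm', nextIndex]

/-- Adds the contributions of all multi-indices. -/
def enumCmd : Cmd := iwhile 9 7 (contributeCmd ;; advanceCmd)

/-- A time bound for the contribution of one multi-index. -/
def contribTime (d n G : ℕ) : ℕ := d * (n * (2 * (d * (8 * G + 9)) + 35) + 13) + 3

/-- Register `9` mirrors the overflow cell `d`, which is zero during the enumeration and one at its
end. The odometer lemma is applied with values in the additive monoid of memory contents. -/
theorem wp_enumCmd {d n D G : ℕ} {β : ℝ} {m : ℕ → ℝ} {s : Store}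
    (hc : Consts d n D β s) (hD : D = d * n) (hG : 1 ≤ G) (h5 : s.ireg 5 = G) (h8 : s.ireg 8 = 0)
    (h9 : s.ireg 9 = 0) (hα : s.imem = 0) (hm : s.fmem = m) :
    enumCmd.Wp ((d + G).choose d * (contribTime d n G + (d * 10 + 8) + 2) + 2)
      (fun s' => Consts d n D β s' ∧
        s'.fmem = m + boxSum (contribution m β d n D d) d G 0) s := by
  obtain ⟨N, hN, hlast, hsum, hgo⟩ :=
    exists_iterate_nextIndex_zero (contribution m β d n D d) d G
  rw [← hsum]
  refine wp_iwhile (N := N) (tb := contribTime d n G + (d * 10 + 8)) (fun t s' => Consts d n D β s' ∧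
    s'.fmem = m + ∑ u ∈ Finset.range t, contribution m β d n D d ((nextIndex d G)^[u] 0) ∧
    s'.ireg 5 = G ∧ s'.imem = (nextIndex d G)^[t] 0 ∧ s'.ireg 8 = total d ((nextIndex d G)^[t] 0) ∧
    s'.ireg 9 = (nextIndex d G)^[t] 0 d) ?_ ?_ ?_ ?_ ?_
    (Nat.add_le_add_right (Nat.mul_le_mul_right _ hN) 2)
  · exact ⟨hc, by simp [hm], h5, hα, by simpa [total] using h8, h9⟩
  · rintro t ht s' ⟨hc', -, -, -, -, h9'⟩
    rw [h9', hc'.r7, (hgo t ht).2]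
    exact one_pos
  · rintro s' ⟨hc', -, -, -, -, h9'⟩
    rw [h9', hc'.r7, hlast]
    exact lt_irrefl _
  · rintro t ht s' ⟨hc', hf, h5', hα', h8', h9'⟩
    obtain ⟨ht1, ht2⟩ := hgo t ht
    refine Wp.seq (wp_contributeCmd (m := m) hc' hD hα' (G := G) (fun l hl => ?_) ?_) ?_ le_rfl
    · refine le_trans ?_ ht1
      exact Finset.single_le_sum (f := (nextIndex d G)^[t] 0) (fun _ _ => Nat.zero_le _)
        (Finset.mem_range.2 (by omega))
    · intro a ha
      rw [hf, Pi.add_apply, Finset.sum_apply, Finset.sum_eq_zero, add_zero]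
      exact fun u _ => contribution_of_lt ha
    · rintro s'' ⟨fr, hf'⟩
      have hc'' := hc'.of_frame (by norm_num) (by norm_num) fr
      refine (wp_advanceCmd hG ht2 ht1 hc''.r2 ((fr.ireg 5 (by norm_num)).trans h5') hc''.r6 hc''.r7
        (fr.imem.trans hα') ((fr.ireg 8 (by norm_num)).trans h8')).mono le_rfl ?_
      rintro s₃ ⟨odo, him, h8₃, h9₃⟩
      rw [Function.iterate_succ_apply']
      refine ⟨odo.consts hc'', ?_, ?_, him, h8₃, h9₃⟩
      · rw [odo.fmem, hf', hf, Finset.sum_range_succ, add_assoc]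
      · rw [odo.ireg 5 (by omega) (by omega) (by omega) (by omega), fr.ireg 5 (by norm_num), h5']
  · rintro s' ⟨hc', hf, -⟩
    exact ⟨hc', hf⟩

/-! ### Preparation -/

/-- Computes `n`, `d * n` and `3 * d * n`. -/
def sizesCmd : Cmd :=
  block [.iconst 7 1, .iadd 3 0 1] ;; loop 10 3 (block [.iadd 4 4 2]) ;;
  block [.iadd 12 4 4, .iadd 12 12 4]

/-- Stores before the enumeration. -/
structure Fresh (d n D : ℕ) (β : ℝ) (m : ℕ → ℝ) (s : Store) : Prop where
  consts : Consts d n D β s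
  r5 : s.ireg 5 = 0
  r8 : s.ireg 8 = 0
  r9 : s.ireg 9 = 0
  imem : s.imem = 0
  fmem : s.fmem = m

theorem Fresh.update {d n D : ℕ} {β : ℝ} {m : ℕ → ℝ} {s : Store} (h : Fresh d n D β m s) {r : ℕ}
    (hr : r ≠ 2 ∧ r ≠ 3 ∧ r ≠ 4 ∧ r ≠ 5 ∧ r ≠ 6 ∧ r ≠ 7 ∧ r ≠ 8 ∧ r ≠ 9 ∧ r ≠ 12) (v : ℕ) :
    Fresh d n D β m { s with ireg := Function.update s.ireg r v } := by
  obtain ⟨⟨a2, a3, a4, a6, a7, a12, b0, b1⟩, a5, a8, a9, him, hfm⟩ := h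
  refine ⟨⟨?_, ?_, ?_, ?_, ?_, ?_, b0, b1⟩, ?_, ?_, ?_, him, hfm⟩ <;>
    (simp only []; rw [Function.update_of_ne (by omega)]; assumption)

theorem Fresh.updateReal {d n D : ℕ} {β : ℝ} {m : ℕ → ℝ} {s : Store} (h : Fresh d n D β m s) {r : ℕ}
    (hr : 2 ≤ r) (v : ℝ) : Fresh d n D β m { s with freg := Function.update s.freg r v } := by
  obtain ⟨⟨a2, a3, a4, a6, a7, a12, b0, b1⟩, a5, a8, a9, him, hfm⟩ := h
  refine ⟨⟨a2, a3, a4, a6, a7, a12, ?_, ?_⟩, a5, a8, a9, him, hfm⟩ <;>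
    (simp only []; rw [Function.update_of_ne (by omega)]; assumption)

theorem wp_sizesCmd {Lp L d : ℕ} {β : ℝ} {m : ℕ → ℝ} {s : Store} (h0 : s.ireg 0 = Lp)
    (h1 : s.ireg 1 = L) (h2 : s.ireg 2 = d) (hr : ∀ r, 3 ≤ r → s.ireg r = 0) (hf : s.freg 0 = β)
    (hf' : ∀ r, 1 ≤ r → s.freg r = 0) (him : s.imem = 0) (hm : s.fmem = m) :
    sizesCmd.Wp ((Lp + L) * 4 + 7) (fun s' =>
      Fresh d (Lp + L) (d * (Lp + L)) β m s' ∧ s'.freg 2 = 0) s := by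
  refine wp_block_seq rfl (t := (Lp + L) * 4 + 5) ?_ (by simp; omega)
  refine Wp.seq (R := fun s' => s'.ireg 4 = d * (Lp + L) ∧ s'.freg = s.freg ∧ s'.imem = s.imem ∧
    s'.fmem = s.fmem ∧ s'.ireg 2 = d ∧ s'.ireg 3 = Lp + L ∧ s'.ireg 5 = 0 ∧ s'.ireg 6 = 0 ∧
    s'.ireg 7 = 1 ∧ s'.ireg 8 = 0 ∧ s'.ireg 9 = 0) (t₁ := (Lp + L) * 4 + 3) (t₂ := 2) ?_ ?_ le_rfl
  · refine wp_loop (N := Lp + L) (tb := 1) (fun k s' => s'.ireg 4 = d * k ∧ s'.freg = s.freg ∧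
      s'.imem = s.imem ∧ s'.fmem = s.fmem ∧ s'.ireg 2 = d ∧ s'.ireg 3 = Lp + L ∧ s'.ireg 5 = 0 ∧
      s'.ireg 6 = 0 ∧ s'.ireg 7 = 1 ∧ s'.ireg 8 = 0 ∧ s'.ireg 9 = 0) ?_ ?_ ?_ ?_ (fun _ h => h) le_rfl
    · intro k s' v h
      simpa using h
    · simp [h0, h1, h2, hr]
    · rintro k s' ⟨-, -, -, -, -, h3, -, -, h7, -⟩
      exact ⟨h3, h7⟩
    · rintro k hk s' ⟨h4, h⟩ h10
      refine wp_block rfl le_rfl ⟨⟨?_, by simpa using h⟩, by simpa using h10⟩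
      simp [h4, h.2.2.2.1]
      ring
  · rintro s' ⟨h4, hf1, him1, hm1, a2, a3, a5, a6, a7, a8, a9⟩
    refine wp_block rfl le_rfl ⟨⟨⟨?_, ?_, ?_, ?_, ?_, ?_, ?_, ?_⟩, ?_, ?_, ?_, ?_, ?_⟩, ?_⟩ <;>
      simp [*]
    ring

/-- Replaces real register `2` by its maximum with register `x`. -/
def maxCmd (x : ℕ) : Cmd := fwhile 2 x (block [.fadd 2 x 1])

/-- A loop serves as a conditional: once the larger value has been copied, by adding zero, the test
fails. -/
theorem wp_maxCmd {x : ℕ} (hx : x ≠ 2) {s : Store} (h1 : s.freg 1 = 0) :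
    (maxCmd x).Wp 5 (fun s' =>
      s' = { s with freg := Function.update s.freg 2 (max (s.freg 2) (s.freg x)) }) s := by
  by_cases h : s.freg 2 < s.freg x
  · refine wp_fwhile_step (t₁ := 1) (t₂ := 2) h (wp_block (Q := fun s' => s' = acts _ s) rfl le_rfl rfl)
      ?_ le_rfl
    rintro s' rfl
    refine wp_fwhile_done ?_ le_rfl ?_
    · simp [h1, hx]
    · simp [h1, max_eq_right h.le]
  · refine wp_fwhile_done h (by norm_num) ?_
    rw [max_eq_left (not_lt.1 h), Function.update_eq_self]

/-- Computes the maximal modulus of the entries. -/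
def boundCmd : Cmd :=
  loop 10 12 (block [.fload 4 10] ;; maxCmd 4 ;; block [.fsub 5 1 4] ;; maxCmd 5)

/-- The bound of the entries by the computed value serves accuracy; the bound of that value by `b`,
which the program does not know, serves the running time. -/
theorem wp_boundCmd {d n D : ℕ} {β b : ℝ} {m : ℕ → ℝ} {s : Store} (hs : Fresh d n D β m s)
    (h2 : s.freg 2 = 0) (hb : 0 ≤ b) (hm : ∀ a < 3 * D, |m a| ≤ b) :
    boundCmd.Wp (3 * D * 15 + 3) (fun s' => Fresh d n D β m s' ∧ 0 ≤ s'.freg 2 ∧ s'.freg 2 ≤ b ∧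
      ∀ a < 3 * D, |m a| ≤ s'.freg 2) s := by
  refine wp_loop (N := 3 * D) (tb := 12) (fun k s' => Fresh d n D β m s' ∧ 0 ≤ s'.freg 2 ∧
    s'.freg 2 ≤ b ∧ ∀ a < k, |m a| ≤ s'.freg 2) ?_ ?_ ?_ ?_ (fun _ h => h) le_rfl
  · rintro k s' v ⟨h, h'⟩
    exact ⟨h.update (by omega) v, h'⟩
  · exact ⟨hs, h2.ge, h2.trans_le hb, by omega⟩
  · rintro k s' ⟨h, -⟩
    exact ⟨h.consts.r12, h.consts.r7⟩
  · rintro k hk s' ⟨h, hp, hle, hall⟩ h10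
    have hv : s'.fmem (s'.ireg 10) = m k := by rw [h.fmem, h10]
    refine wp_block_seq rfl (t := 11) ?_ (by simp)
    refine Wp.seq (wp_maxCmd (by norm_num) (by simpa using h.consts.f1)) ?_ (t₂ := 6) le_rfl
    rintro s₁ rfl
    refine wp_block_seq rfl (t := 5) ?_ (by simp)
    refine (wp_maxCmd (by norm_num) (by simpa using h.consts.f1)).mono le_rfl ?_
    rintro s₂ rfl
    have hval : max (max (s'.freg 2) (m k)) (-m k) = max (s'.freg 2) |m k| := by
      rw [max_assoc]; rfl
    refine ⟨⟨?_, ?_⟩, by simpa using h10⟩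
    · have := (((h.updateReal (r := 4) (by norm_num) (m k)).updateReal (r := 2) (by norm_num)
        (max (s'.freg 2) (m k))).updateReal (r := 5) (by norm_num) (-m k)).updateReal (r := 2)
        (by norm_num) (max (s'.freg 2) |m k|)
      simpa [hv, h.consts.f1, hval] using this
    · simp only [acts_cons, acts_nil, RInstr.act_fsub, RInstr.act_fload]
      simp only [Function.update_self, ne_eq, Nat.reduceEqDiff, not_false_eq_true,
        Function.update_of_ne, hv, h.consts.f1, zero_sub, hval, OfNat.one_ne_ofNat]
      refine ⟨le_max_of_le_left hp, max_le hle (hm k hk), fun a ha => ?_⟩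
      rcases Nat.lt_succ_iff_lt_or_eq.1 ha with h' | rfl
      · exact le_max_of_le_left (hall a h')
      · exact le_max_right _ _

/-- Computes `2 * β * d * M ^ 2` and `(M + 1) * N * (n + 1) ^ c` for the content `M` of real
register `2`. -/
def weightCmd (N c : ℕ) : Cmd :=
  block [.fcast 6 2, .fmul 6 6 0, .fmul 6 6 2, .fmul 6 6 2, .fadd 6 6 6, .fcast 7 7, .fadd 3 2 7,
    .iconst 14 N, .fcast 8 14, .fmul 3 3 8, .iadd 15 3 7, .fcast 8 15, .iconst 14 c] ;;
  loop 10 14 (block [.fmul 3 3 8])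

theorem wp_weightCmd {d n D N c : ℕ} {β M : ℝ} {m : ℕ → ℝ} {s : Store} (hs : Fresh d n D β m s)
    (h2 : s.freg 2 = M) :
    (weightCmd N c).Wp (c * 4 + 16) (fun s' => Fresh d n D β m s' ∧
      s'.freg 6 = 2 * (β * d * M ^ 2) ∧ s'.freg 7 = 1 ∧
      s'.freg 3 = (M + 1) * N * (n + 1 : ℝ) ^ c) s := by
  refine wp_block_seq rfl (t := c * 4 + 3) ?_ (by simp; omega)
  refine wp_loop (N := c) (tb := 1) (fun k s' => Fresh d n D β m s' ∧ s'.ireg 14 = c ∧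
      s'.freg 6 = 2 * (β * d * M ^ 2) ∧ s'.freg 7 = 1 ∧ s'.freg 8 = n + 1 ∧
      s'.freg 3 = (M + 1) * N * (n + 1 : ℝ) ^ k) ?_ ?_ ?_ ?_ ?_ le_rfl
  · rintro k s' v ⟨h, h', h''⟩
    exact ⟨h.update (by omega) v, by simpa using h', h''⟩
  · have hc := hs.consts
    refine ⟨⟨⟨?_, ?_, ?_, ?_, ?_, ?_, ?_, ?_⟩, ?_, ?_, ?_, ?_, ?_⟩, ?_, ?_, ?_, ?_, ?_⟩
    all_goals simp [hc.r2, hc.r3, hc.r4, hc.r6, hc.r7, hc.r12, hc.f0, hc.f1, hs.r5, hs.r8, hs.r9,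
      hs.imem, hs.fmem, h2]
    ring
  · rintro k s' ⟨h, h', -⟩
    exact ⟨h', h.consts.r7⟩
  · rintro k hk s' ⟨h, h14, h6, h7, h8, h3⟩ h10
    refine wp_block rfl le_rfl ⟨⟨h.updateReal (r := 3) (by norm_num) _, ?_, ?_, ?_, ?_, ?_⟩, ?_⟩
    · simpa using h14
    · simpa using h6
    · simpa using h7
    · simpa using h8
    · simp [h3, h8]
      ring
    · simpa using h10
  · rintro s' ⟨h, -, h6, h7, -, h3⟩
    exact ⟨h, h6, h7, h3⟩

/-- Finds the truncation order. -/
def orderCmd : Cmd := fwhile 7 3 (block [.iadd 5 5 7, .fcast 8 5, .fmul 3 3 6, .fdiv 3 3 8])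

/-- Register `3` runs through `W * y ^ k / k!` until it drops to one or below, so the least
admissible order is found. It is positive because `W > 1`; both the odometer and
`le_of_pow_div_factorial_le_one` rely on this. -/
theorem wp_orderCmd {d n D G₀ : ℕ} {β W y : ℝ} {m : ℕ → ℝ} {s : Store} (hs : Fresh d n D β m s)
    (h3 : s.freg 3 = W) (h6 : s.freg 6 = y) (h7 : s.freg 7 = 1) (hW : 1 < W)
    (hG : W * (y ^ G₀ / G₀.factorial) ≤ 1) :
    orderCmd.Wp (G₀ * 6 + 2) (fun s' => Consts d n D β s' ∧ s'.ireg 8 = 0 ∧ s'.ireg 9 = 0 ∧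
      s'.imem = 0 ∧ s'.fmem = m ∧
      ∃ G, 1 ≤ G ∧ G ≤ G₀ ∧ s'.ireg 5 = G ∧ W * (y ^ G / G.factorial) ≤ 1) s := by
  classical
  have hex : ∃ G, W * (y ^ G / (G.factorial : ℝ)) ≤ 1 := ⟨G₀, hG⟩
  have hle : Nat.find hex ≤ G₀ := Nat.find_min' hex hG
  have hpos : 1 ≤ Nat.find hex := by
    rw [Nat.one_le_iff_ne_zero]
    intro h
    have := Nat.find_spec hex
    rw [h] at this
    simp at this
    linarith
  refine wp_fwhile (N := Nat.find hex) (tb := 4) (fun k s' => Consts d n D β s' ∧ s'.ireg 8 = 0 ∧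
    s'.ireg 9 = 0 ∧ s'.imem = 0 ∧ s'.fmem = m ∧ s'.freg 6 = y ∧ s'.freg 7 = 1 ∧ s'.ireg 5 = k ∧
    s'.freg 3 = W * (y ^ k / k.factorial)) ?_ ?_ ?_ ?_ ?_ (by omega)
  · exact ⟨hs.consts, hs.r8, hs.r9, hs.imem, hs.fmem, h6, h7, hs.r5, by simp [h3]⟩
  · rintro k hk s' ⟨-, -, -, -, -, -, h7, -, h3⟩
    rw [h7, h3]
    exact not_le.1 (Nat.find_min hex hk)
  · rintro s' ⟨-, -, -, -, -, -, h7, -, h3⟩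
    rw [h7, h3]
    exact not_lt.2 (Nat.find_spec hex)
  · rintro k hk s' ⟨hc, h8, h9, him, hfm, h6, h7, h5, h3⟩
    refine wp_block rfl le_rfl ⟨⟨?_, ?_, ?_, ?_, ?_, ?_, ?_, ?_⟩, ?_, ?_, ?_, ?_, ?_, ?_, ?_, ?_⟩
    all_goals simp [hc.r2, hc.r3, hc.r4, hc.r6, hc.r7, hc.r12, hc.f0, hc.f1, h5, h8, h9,
      him, hfm, h6, h7, h3]
    rw [Nat.factorial_succ, pow_succ]
    push_cast
    field_simp
  · rintro s' ⟨hc, h8, h9, him, hfm, -, -, h5, -⟩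
    exact ⟨hc, h8, h9, him, hfm, _, hpos, hle, h5, Nat.find_spec hex⟩

/-! ### The whole program -/

/-- Writes the quotients of the accumulators to the beginning of the memory. -/
def outputCmd : Cmd :=
  loop 10 4 (block [.iadd 16 12 10, .fload 4 16, .iadd 16 16 4, .fload 5 16, .fdiv 4 4 5,
    .fstore 10 4])

theorem wp_outputCmd {d n D : ℕ} {β : ℝ} {f : ℕ → ℝ} {s : Store} (hc : Consts d n D β s)
    (hf : s.fmem = f) :
    outputCmd.Wp (D * 9 + 3) (fun s' => ∀ a < D, s'.fmem a = f (3 * D + a) / f (4 * D + a)) s := by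
  refine wp_loop (N := D) (tb := 6) (fun k s' => s'.ireg 4 = D ∧ s'.ireg 7 = 1 ∧
    s'.ireg 12 = 3 * D ∧ (∀ a < k, s'.fmem a = f (3 * D + a) / f (4 * D + a)) ∧
    ∀ a, D ≤ a → s'.fmem a = f a) ?_ ?_ ?_ ?_ ?_ le_rfl
  · intro k s' v h
    simpa using h
  · exact ⟨hc.r4, hc.r7, hc.r12, by omega, fun a _ => by rw [hf]⟩
  · rintro k s' ⟨h4, h7, -⟩
    exact ⟨h4, h7⟩
  · rintro k hk s' ⟨h4, h7, h12, hlo, hhi⟩ h10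
    have e1 := hhi (3 * D + k) (by omega)
    have e2 := hhi (4 * D + k) (by omega)
    rw [show 4 * D + k = 3 * D + k + D by ring] at e2
    refine wp_block rfl le_rfl ⟨⟨?_, ?_, ?_, ?_, ?_⟩, ?_⟩
    · simpa using h4
    · simpa using h7
    · simpa using h12
    · intro a ha
      rcases Nat.lt_succ_iff_lt_or_eq.1 ha with h' | rfl
      · simp [h10, Function.update_of_ne h'.ne, hlo a h']
      · simp [h10, h12, h4, e1, e2, show 4 * D + a = 3 * D + a + D by ring]
    · intro a ha
      simp [h10, Function.update_of_ne (show a ≠ k by omega), hhi a ha]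
    · simpa using h10
  · rintro s' ⟨-, -, -, h, -⟩
    exact h

/-- Prompt tuning inference with the accuracy `8 / (N * (n + 1) ^ c)`. -/
def aptiCmd (N c : ℕ) : Cmd :=
  sizesCmd ;; boundCmd ;; weightCmd N c ;; orderCmd ;; enumCmd ;; outputCmd

/-- A time bound for the program when the truncation order is at most `G`. -/
def aptiTime (c d n G : ℕ) : ℕ :=
  (n * 4 + 7) + ((3 * (d * n) * 15 + 3) + ((c * 4 + 16) + ((G * 6 + 2) +
    (((d + G).choose d * (contribTime d n G + (d * 10 + 8) + 2) + 2) + (d * n * 9 + 3)))))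

theorem contribTime_mono (d n : ℕ) {G G' : ℕ} (h : G ≤ G') :
    contribTime d n G ≤ contribTime d n G' := by
  unfold contribTime
  gcongr

theorem wp_aptiCmd {Lp L d N c G₀ : ℕ} {β b : ℝ} {m : ℕ → ℝ} {s : Store} (h0 : s.ireg 0 = Lp)
    (h1 : s.ireg 1 = L) (h2 : s.ireg 2 = d) (hr : ∀ r, 3 ≤ r → s.ireg r = 0) (hf : s.freg 0 = β)
    (hf' : ∀ r, 1 ≤ r → s.freg r = 0) (him : s.imem = 0) (hm : s.fmem = m) (hβ : 0 ≤ β) (hb : 0 ≤ b)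
    (hmb : ∀ a < 3 * (d * (Lp + L)), |m a| ≤ b) (hN : 2 ≤ N)
    (hG : (b + 1) * N * ((Lp + L : ℕ) + 1 : ℝ) ^ c * ((2 * (β * d * b ^ 2)) ^ G₀ / G₀.factorial) ≤ 1) :
    (aptiCmd N c).Wp (aptiTime c d (Lp + L) G₀) (fun s' => ∃ (M : ℝ) (G : ℕ), 0 ≤ M ∧ 1 ≤ G ∧
      (∀ a < 3 * (d * (Lp + L)), |m a| ≤ M) ∧
      (M + 1) * N * ((Lp + L : ℕ) + 1 : ℝ) ^ c * ((2 * (β * d * M ^ 2)) ^ G / G.factorial) ≤ 1 ∧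
      ∀ a < d * (Lp + L), s'.fmem a
        = (m + boxSum (contribution m β d (Lp + L) (d * (Lp + L)) d) d G 0) (3 * (d * (Lp + L)) + a)
        / (m + boxSum (contribution m β d (Lp + L) (d * (Lp + L)) d) d G 0) (4 * (d * (Lp + L)) + a))
      s := by
  refine Wp.seq (wp_sizesCmd h0 h1 h2 hr hf hf' him hm) ?_ le_rfl
  rintro s₁ ⟨fr₁, z₁⟩
  refine Wp.seq (wp_boundCmd fr₁ z₁ hb hmb) ?_ le_rfl
  rintro s₂ ⟨fr₂, hM0, hMb, hM⟩
  refine Wp.seq (wp_weightCmd (N := N) (c := c) fr₂ rfl) ?_ le_rfl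
  rintro s₃ ⟨fr₃, h6, h7, h3⟩
  have hN' : (2 : ℝ) ≤ N := by exact_mod_cast hN
  have hn1 : (1 : ℝ) ≤ ((Lp + L : ℕ) + 1 : ℝ) ^ c :=
    one_le_pow₀ (le_add_of_nonneg_left (Nat.cast_nonneg _))
  have hW : 1 < (s₂.freg 2 + 1) * N * ((Lp + L : ℕ) + 1 : ℝ) ^ c := by
    nlinarith [mul_le_mul (show (1 : ℝ) ≤ s₂.freg 2 + 1 by linarith) hN' (by norm_num) (by linarith)]
  refine Wp.seq (wp_orderCmd (G₀ := G₀) fr₃ h3 h6 h7 hW (le_trans ?_ hG)) ?_ le_rfl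
  -- The condition is monotone in the bound on the entries, so `G₀` is also admissible for the
  -- smaller computed maximum.
  · gcongr
  rintro s₄ ⟨hc, h8, h9, him₄, hm₄, G, hG1, hG2, h5, hG3⟩
  refine Wp.seq ((wp_enumCmd hc rfl hG1 h5 h8 h9 him₄ hm₄).mono ?_ fun _ h => h) ?_ le_rfl
  · have := contribTime_mono d (Lp + L) hG2
    gcongr
  rintro s₅ ⟨hc₅, hm₅⟩
  refine (wp_outputCmd hc₅ hm₅).mono le_rfl ?_
  intro s₆ h
  exact ⟨_, G, hM0, hG1, hM, hG3, h⟩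

/-! ### The value of the accumulators -/

theorem mul_add_inj {d i i' j j' : ℕ} (hi : i < d) (hi' : i' < d) (h : d * j + i = d * j' + i') :
    j = j' ∧ i = i' := by
  have hd : 0 < d := by omega
  have h1 := congrArg (· / d) h
  have h2 := congrArg (· % d) h
  simp only [Nat.mul_add_div hd, Nat.div_eq_of_lt hi, Nat.div_eq_of_lt hi', Nat.mul_add_mod,
    Nat.mod_eq_of_lt hi, Nat.mod_eq_of_lt hi', add_zero] at h1 h2
  exact ⟨h1, h2⟩

/-- Different pairs `(j, i)` have different offsets `d * j + i`, all below `d * n`, so neither cells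
nor the two blocks of accumulators collide. -/
theorem scatter_apply {d n i i' j : ℕ} (x : ℕ → ℝ) (v₁ v₀ : ℝ) (hi : i < d) (hi' : i' < d)
    (hj : j < n) :
    scatter d (d * n) i' x v₁ v₀ n (3 * (d * n) + (d * j + i)) = (if i' = i then x j * v₁ else 0) ∧
    scatter d (d * n) i' x v₁ v₀ n (4 * (d * n) + (d * j + i)) = (if i' = i then x j * v₀ else 0) := by
  have hlt := mul_add_lt_mul hi hj
  have hne : ∀ k < n, k ≠ j ∨ i' ≠ i → d * j + i ≠ d * k + i' := by
    intro k _ h he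
    have := mul_add_inj hi hi' he
    omega
  have hlt' : ∀ k < n, d * k + i' < d * n := fun k hk => mul_add_lt_mul hi' hk
  constructor <;>
  · rw [scatter, Finset.sum_apply, Finset.sum_eq_single_of_mem j (Finset.mem_range.2 hj)]
    · have h1 := hlt' j hj
      rw [Pi.add_apply]
      split_ifs with h
      · subst h
        rw [Pi.single_apply, Pi.single_apply]
        simp
        intro h
        omega
      · have h2 := hne j hj (Or.inr h)
        rw [Pi.single_eq_of_ne (by omega), Pi.single_eq_of_ne (by omega), add_zero]
    · intro k hk hkj
      rw [Finset.mem_range] at hk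
      have h1 := hlt' k hk
      have h2 := hne k hk (Or.inl hkj)
      rw [Pi.add_apply, Pi.single_eq_of_ne (by omega), Pi.single_eq_of_ne (by omega), add_zero]

/-- The separated factors recombine into one term of the multinomial expansion of the exponential of
the score. -/
theorem phi_mul_psi (m : ℕ → ℝ) (β : ℝ) (d D : ℕ) (α : ℕ → ℕ) (k j : ℕ) :
    phi m d D α k * psi m β d α j = ∏ l ∈ Finset.range d,
      (β * (m (D + d * k + l) * m (d * j + l))) ^ α l / (α l).factorial := by
  rw [phi, psi, ← Finset.prod_mul_distrib]
  refine Finset.prod_congr rfl fun l _ => ?_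
  have h : ∏ a ∈ Finset.range (α l), ((a + 1 : ℕ) : ℝ) = (α l).factorial := by
    rw [← Finset.prod_range_add_one_eq_factorial]
    push_cast
    rfl
  rw [Finset.prod_div_distrib, h, Finset.prod_const, Finset.prod_const, Finset.card_range,
    ← mul_div_assoc, ← mul_pow]
  ring

/-- The scaled inner product of column `k` of `K` and column `j` of `Q`. -/
def score (m : ℕ → ℝ) (β : ℝ) (d D k j : ℕ) : ℝ :=
  ∑ l ∈ Finset.range d, β * (m (D + d * k + l) * m (d * j + l))

/-- The factor `1 *` gives the denominator the shape that `boxSum_sum` expects. -/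
theorem contribution_apply {d n i j : ℕ} (m : ℕ → ℝ) (β : ℝ) (α : ℕ → ℕ) (hi : i < d) (hj : j < n) :
    contribution m β d n (d * n) d α (3 * (d * n) + (d * j + i)) = ∑ k ∈ Finset.range n,
      m (2 * (d * n) + d * k + i) * (phi m d (d * n) α k * psi m β d α j) ∧
    contribution m β d n (d * n) d α (4 * (d * n) + (d * j + i)) = ∑ k ∈ Finset.range n,
      1 * (phi m d (d * n) α k * psi m β d α j) := by
  constructor <;>
  · rw [contribution, Finset.sum_apply, Finset.sum_eq_single_of_mem i (Finset.mem_range.2 hi)]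
    · first
      | rw [(scatter_apply _ _ _ hi hi hj).1]
      | rw [(scatter_apply _ _ _ hi hi hj).2]
      rw [if_pos rfl, Finset.mul_sum]
      exact Finset.sum_congr rfl fun k _ => by ring
    · intro i' hi' hne
      first
      | rw [(scatter_apply _ _ _ hi (Finset.mem_range.1 hi') hj).1, if_neg hne]
      | rw [(scatter_apply _ _ _ hi (Finset.mem_range.1 hi') hj).2, if_neg hne]

/-- Exchange the sum over multi-indices with the sum over the columns of `K`. The result is exact:
truncating the series is the only source of error. -/
theorem boxSum_contribution {d n i j : ℕ} (m : ℕ → ℝ) (β : ℝ) (G : ℕ) (hi : i < d) (hj : j < n) :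
    boxSum (contribution m β d n (d * n) d) d G 0 (3 * (d * n) + (d * j + i))
      = ∑ k ∈ Finset.range n, m (2 * (d * n) + d * k + i) * expTrunc G (score m β d (d * n) k j) ∧
    boxSum (contribution m β d n (d * n) d) d G 0 (4 * (d * n) + (d * j + i))
      = ∑ k ∈ Finset.range n, expTrunc G (score m β d (d * n) k j) := by
  have h : ∀ k, boxSum (fun α => ∏ l ∈ Finset.range d,
      (β * (m (d * n + d * k + l) * m (d * j + l))) ^ α l / (α l).factorial) d G 0
      = expTrunc G (score m β d (d * n) k j) := by
    intro k
    rw [boxSum_monomial d (fun l => β * (m (d * n + d * k + l) * m (d * j + l))) d le_rfl G 0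
      (fun _ _ => rfl)]
    simp [score]
  constructor
  · rw [boxSum_apply]
    simp only [(contribution_apply m β _ hi hj).1, phi_mul_psi]
    rw [boxSum_sum]
    simp only [h]
  · rw [boxSum_apply]
    simp only [(contribution_apply m β _ hi hj).2, phi_mul_psi]
    rw [boxSum_sum]
    simp only [h, one_mul]

/-! ### Accuracy -/

/-- The Taylor remainder is an absolute error, but a relative one is needed and `exp x` may be as
small as `exp (-X)`. Since `X ≤ G / 2` and `exp (1 / 2) ≤ 2`, the loss `exp X` is at most `2 ^ G`;
this turns `X ^ G` into `(2 * X) ^ G`. -/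
theorem abs_expTrunc_sub_exp_le {G : ℕ} {x X : ℝ} (hx : |x| ≤ X) (hX : 2 * X ≤ G) :
    |expTrunc G x - Real.exp x| ≤ 2 * ((2 * X) ^ G / G.factorial) * Real.exp x := by
  have hX0 : 0 ≤ X := (abs_nonneg x).trans hx
  have hf : (0 : ℝ) < G.factorial := by exact_mod_cast G.factorial_pos
  have h1 : |expTrunc G x - Real.exp x| ≤ |x| ^ (G + 1) / (G + 1).factorial * 2 := by
    have h := Complex.exp_bound' (x := (x : ℂ)) (n := G + 1) (by
      rw [Complex.norm_real, Real.norm_eq_abs, div_le_iff₀ (by positivity)]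
      push_cast
      linarith)
    rw [Complex.norm_real, Real.norm_eq_abs] at h
    refine le_trans (le_of_eq ?_) h
    rw [abs_sub_comm, ← Real.norm_eq_abs, ← Complex.norm_real]
    push_cast [expTrunc]
    rfl
  have h2 : |x| ^ (G + 1) / ((G + 1).factorial : ℝ) ≤ X ^ G / G.factorial := by
    calc |x| ^ (G + 1) / ((G + 1).factorial : ℝ) ≤ X ^ (G + 1) / ((G + 1).factorial : ℝ) := by gcongr
      _ = X ^ G / G.factorial * (X / (G + 1)) := by
        rw [Nat.factorial_succ, pow_succ]; push_cast; field_simp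
      _ ≤ X ^ G / G.factorial * 1 := by
        gcongr
        rw [div_le_one (by positivity)]
        linarith
      _ = _ := mul_one _
  have h3 : Real.exp (1 / 2) ≤ 2 := by
    have h4 : Real.exp (1 / 2) ^ 2 = Real.exp 1 := by rw [← Real.exp_nat_mul]; norm_num
    nlinarith [Real.exp_one_lt_d9, Real.exp_pos (1 / 2)]
  have h5 : Real.exp X ≤ 2 ^ G :=
    calc Real.exp X ≤ Real.exp (G * (1 / 2)) := Real.exp_le_exp.2 (by linarith)
      _ = Real.exp (1 / 2) ^ G := Real.exp_nat_mul _ _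
      _ ≤ 2 ^ G := by gcongr
  have h6 : 1 ≤ 2 ^ G * Real.exp x := by
    have : Real.exp (-X) ≤ Real.exp x := Real.exp_le_exp.2 (by linarith [(abs_le.1 hx).1])
    calc (1 : ℝ) = Real.exp X * Real.exp (-X) := by rw [← Real.exp_add]; simp
      _ ≤ 2 ^ G * Real.exp x := by gcongr
  calc |expTrunc G x - Real.exp x| ≤ X ^ G / G.factorial * 2 := h1.trans (by gcongr)
    _ ≤ (X ^ G / G.factorial * 2) * (2 ^ G * Real.exp x) := le_mul_of_one_le_right (by positivity) h6
    _ = 2 * ((2 * X) ^ G / G.factorial) * Real.exp x := by rw [mul_pow]; ring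

/-- Weighted means are stable under relative perturbations of the weights. -/
theorem abs_weighted_mean_sub_le {ι : Type*} (s : Finset ι) (hs : s.Nonempty) (a b v : ι → ℝ)
    {η M : ℝ} (hη : 0 ≤ η) (hη' : η ≤ 1 / 2) (hM : 0 ≤ M) (ha : ∀ k ∈ s, 0 < a k)
    (hab : ∀ k ∈ s, |b k - a k| ≤ η * a k) (hv : ∀ k ∈ s, |v k| ≤ M) :
    |(∑ k ∈ s, v k * b k) / (∑ k ∈ s, b k) - (∑ k ∈ s, v k * a k) / (∑ k ∈ s, a k)| ≤ 4 * η * M := by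
  set A := ∑ k ∈ s, a k with hA
  set C := ∑ k ∈ s, b k with hC
  have hA0 : 0 < A := Finset.sum_pos ha hs
  have hCA : |C - A| ≤ η * A := by
    rw [hA, hC, ← Finset.sum_sub_distrib, Finset.mul_sum]
    exact (Finset.abs_sum_le_sum_abs _ _).trans (Finset.sum_le_sum hab)
  -- As `η ≤ 1 / 2`, the perturbed denominator keeps at least half of its size; this doubles the
  -- final constant from two to four.
  have hC0 : A ≤ 2 * C := by nlinarith [(abs_le.1 hCA).1]
  have hCpos : 0 < C := by linarith
  have h1 : |∑ k ∈ s, v k * b k - ∑ k ∈ s, v k * a k| ≤ M * (η * A) := by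
    rw [hA, ← Finset.sum_sub_distrib, Finset.mul_sum, Finset.mul_sum]
    refine (Finset.abs_sum_le_sum_abs _ _).trans (Finset.sum_le_sum fun k hk => ?_)
    rw [← mul_sub, abs_mul]
    exact mul_le_mul (hv k hk) (hab k hk) (abs_nonneg _) hM
  have h2 : |∑ k ∈ s, v k * a k| ≤ M * A := by
    rw [hA, Finset.mul_sum]
    refine (Finset.abs_sum_le_sum_abs _ _).trans (Finset.sum_le_sum fun k hk => ?_)
    rw [abs_mul, abs_of_pos (ha k hk)]
    exact mul_le_mul_of_nonneg_right (hv k hk) (ha k hk).le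
  set S := ∑ k ∈ s, v k * b k
  set T := ∑ k ∈ s, v k * a k
  have e : S / C - T / A = ((S - T) * A - T * (C - A)) / (C * A) := by
    field_simp
    ring
  rw [e, abs_div, abs_of_pos (mul_pos hCpos hA0), div_le_iff₀ (mul_pos hCpos hA0)]
  calc |(S - T) * A - T * (C - A)| ≤ |(S - T) * A| + |T * (C - A)| := abs_sub _ _
    _ = |S - T| * A + |T| * |C - A| := by rw [abs_mul, abs_mul, abs_of_pos hA0]
    _ ≤ M * (η * A) * A + M * A * (η * A) := by gcongr
    _ = 2 * η * M * A * A := by ring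
    _ ≤ 2 * η * M * A * (2 * C) := by gcongr
    _ = 4 * η * M * (C * A) := by ring

/-- Because `G! ≤ G ^ G`, the stopping condition of the search already yields the hypothesis `2 * X
≤ G` of the Taylor estimate. -/
theorem le_of_pow_div_factorial_le_one {G : ℕ} (hG : 1 ≤ G) {y : ℝ}
    (h : y ^ G / G.factorial ≤ 1) : y ≤ G := by
  have hf : (0 : ℝ) < G.factorial := by exact_mod_cast G.factorial_pos
  rw [div_le_one hf] at h
  have h1 : (G.factorial : ℝ) ≤ (G : ℝ) ^ G := by exact_mod_cast Nat.factorial_le_pow G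
  exact le_of_pow_le_pow_left₀ (by omega) (Nat.cast_nonneg G) (h.trans h1)

theorem abs_score_le {m : ℕ → ℝ} {β M : ℝ} {d n k j : ℕ} (hβ : 0 ≤ β) (hM : 0 ≤ M)
    (hm : ∀ a < 3 * (d * n), |m a| ≤ M) (hk : k < n) (hj : j < n) :
    |score m β d (d * n) k j| ≤ β * d * M ^ 2 := by
  calc |score m β d (d * n) k j|
      ≤ ∑ l ∈ Finset.range d, |β * (m (d * n + d * k + l) * m (d * j + l))| :=
        Finset.abs_sum_le_sum_abs _ _
    _ ≤ ∑ l ∈ Finset.range d, β * (M * M) := by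
        refine Finset.sum_le_sum fun l hl => ?_
        have h1 := mul_add_lt_mul (Finset.mem_range.1 hl) hk
        have h2 := mul_add_lt_mul (Finset.mem_range.1 hl) hj
        rw [abs_mul, abs_mul, abs_of_nonneg hβ]
        have h3 := hm (d * n + d * k + l) (by omega)
        have h4 := hm (d * j + l) (by omega)
        gcongr
    _ = β * d * M ^ 2 := by
        rw [Finset.sum_const, Finset.card_range, nsmul_eq_mul]; ring

/-- The relative error `η = 2 * q` gives the error `4 * η * M = 8 * M * q`, whence the `8 / ε`. The
weight is `M + 1` instead of `M` so that `q` itself is small even when `M` is. -/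
theorem abs_quotient_sub_le {m : ℕ → ℝ} {β M ε : ℝ} {d n i j G : ℕ} (hβ : 0 ≤ β) (hM : 0 ≤ M)
    (hε : ε ≤ 1) (hε0 : 0 < ε)
    (hm : ∀ a < 3 * (d * n), |m a| ≤ M) (hm' : ∀ a, 3 * (d * n) ≤ a → m a = 0) (hG1 : 1 ≤ G)
    (hG : (M + 1) * (8 / ε) * ((2 * (β * d * M ^ 2)) ^ G / G.factorial) ≤ 1) (hi : i < d) (hj : j < n) :
    |(m + boxSum (contribution m β d n (d * n) d) d G 0) (3 * (d * n) + (d * j + i))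
        / (m + boxSum (contribution m β d n (d * n) d) d G 0) (4 * (d * n) + (d * j + i))
      - (∑ k ∈ Finset.range n, m (2 * (d * n) + d * k + i) * Real.exp (score m β d (d * n) k j))
        / ∑ k ∈ Finset.range n, Real.exp (score m β d (d * n) k j)| ≤ ε := by
  set X := β * d * M ^ 2 with hX
  have hX0 : 0 ≤ X := by positivity
  set q := (2 * X) ^ G / (G.factorial : ℝ) with hq
  have hq0 : 0 ≤ q := by positivity
  have hq1 : 8 * ((M + 1) * q) ≤ ε := by
    have : (M + 1) * (8 / ε) * q = 8 * ((M + 1) * q) / ε := by ring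
    rwa [this, div_le_one hε0] at hG
  have hqM : 0 ≤ M * q := by positivity
  have hle : 2 * X ≤ G :=
    le_of_pow_div_factorial_le_one hG1 (by nlinarith)
  rw [Pi.add_apply, Pi.add_apply, hm' _ (by omega), hm' _ (by omega), zero_add, zero_add,
    (boxSum_contribution m β G hi hj).1, (boxSum_contribution m β G hi hj).2]
  refine (abs_weighted_mean_sub_le (Finset.range n) ⟨j, Finset.mem_range.2 hj⟩ _ _ _ (η := 2 * q)
    (M := M) (by positivity) (by nlinarith) hM (fun k _ => Real.exp_pos _) (fun k hk => ?_)
    (fun k hk => ?_)).trans (by nlinarith)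
  · exact abs_expTrunc_sub_exp_le (abs_score_le hβ hM hm (Finset.mem_range.1 hk) hj) hle
  · have := mul_add_lt_mul hi (Finset.mem_range.1 hk)
    exact hm _ (by omega)

/-! ### The input -/

theorem flatten_of_le {d n : ℕ} (M : Matrix (Fin d) (Fin n) ℝ) {a : ℕ} (ha : d * n ≤ a) :
    flatten M a = 0 := by
  rw [flatten, dif_neg]
  rintro ⟨h1, h2⟩
  have hd : 0 < d := by omega
  rw [Nat.div_lt_iff_lt_mul hd] at h2
  rw [mul_comm] at h2
  omega

theorem abs_flatten_le {d n : ℕ} {M : Matrix (Fin d) (Fin n) ℝ} {b : ℝ} (hb : 0 ≤ b)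
    (h : maxNorm M ≤ b) (a : ℕ) : |flatten M a| ≤ b := by
  rw [flatten]
  split_ifs
  · exact (maxNorm_le_iff M hb).1 h _ _
  · simpa using hb

variable {Lp L d : ℕ} {β : ℝ} {Q K V : Matrix (Fin d) (Fin (Lp + L)) ℝ}

/-- The accumulators therefore start at zero without being initialised. -/
theorem aptiInput_fmem_of_le {a : ℕ} (ha : 3 * (d * (Lp + L)) ≤ a) :
    (aptiInput Lp L d β Q K V).fmem a = 0 := by
  simp only [aptiInput]
  rw [if_neg (by omega), if_neg (by omega), flatten_of_le _ (by omega)]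

theorem abs_aptiInput_fmem_le {b : ℝ} (hb : 0 ≤ b)
    (h : max (max (maxNorm Q) (maxNorm K)) (maxNorm V) ≤ b) (a : ℕ) :
    |(aptiInput Lp L d β Q K V).fmem a| ≤ b := by
  simp only [max_le_iff] at h
  simp only [aptiInput]
  split_ifs
  · exact abs_flatten_le hb h.1.1 _
  · exact abs_flatten_le hb h.1.2 _
  · exact abs_flatten_le hb h.2 _

theorem aptiInput_fmem_Q (i : Fin d) (j : Fin (Lp + L)) :
    (aptiInput Lp L d β Q K V).fmem (d * j + i) = Q i j := by
  have := mul_add_lt_mul i.isLt j.isLt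
  simp only [aptiInput]
  rw [if_pos this, flatten_apply]

theorem aptiInput_fmem_K (i : Fin d) (j : Fin (Lp + L)) :
    (aptiInput Lp L d β Q K V).fmem (d * (Lp + L) + d * j + i) = K i j := by
  have := mul_add_lt_mul i.isLt j.isLt
  simp only [aptiInput]
  rw [if_neg (by omega), if_pos (by omega),
    show d * (Lp + L) + d * j + i - d * (Lp + L) = d * j + i by omega, flatten_apply]

theorem aptiInput_fmem_V (i : Fin d) (j : Fin (Lp + L)) :
    (aptiInput Lp L d β Q K V).fmem (2 * (d * (Lp + L)) + d * j + i) = V i j := by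
  have := mul_add_lt_mul i.isLt j.isLt
  simp only [aptiInput]
  rw [if_neg (by omega), if_neg (by omega),
    show 2 * (d * (Lp + L)) + d * j + i - 2 * (d * (Lp + L)) = d * j + i by omega, flatten_apply]

theorem score_aptiInput (k j : Fin (Lp + L)) :
    score (aptiInput Lp L d β Q K V).fmem β d (d * (Lp + L)) k j
      = (β • (K.transpose * Q)) k j := by
  rw [score, Finset.sum_range, Matrix.smul_apply, Matrix.mul_apply, smul_eq_mul, Finset.mul_sum]
  refine Finset.sum_congr rfl fun l _ => ?_
  rw [aptiInput_fmem_K, aptiInput_fmem_Q, Matrix.transpose_apply]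

theorem attention_apply (i : Fin d) (j : Fin (Lp + L)) :
    attention β Q K V i j =
      (∑ k ∈ Finset.range (Lp + L), (aptiInput Lp L d β Q K V).fmem (2 * (d * (Lp + L)) + d * k + i)
        * Real.exp (score (aptiInput Lp L d β Q K V).fmem β d (d * (Lp + L)) k j))
      / ∑ k ∈ Finset.range (Lp + L),
        Real.exp (score (aptiInput Lp L d β Q K V).fmem β d (d * (Lp + L)) k j) := by
  rw [Finset.sum_range, Finset.sum_range, attention, Matrix.mul_apply, Finset.sum_div]
  refine Finset.sum_congr rfl fun k _ => ?_
  simp only [aptiInput_fmem_V, score_aptiInput, colSoftmax, Matrix.of_apply, mul_div_assoc]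

/-- The program solves the problem as soon as the order `G₀` is large enough for the bound `b`. -/
theorem solvesAPTI_aptiCmd {N c G₀ : ℕ} {b δ : ℝ} (hβ : 0 ≤ β) (hb : 0 ≤ b) (hN : 8 ≤ N)
    (hδ : 8 / (N * ((Lp + L : ℕ) + 1 : ℝ) ^ c) ≤ δ)
    (hG : (b + 1) * N * ((Lp + L : ℕ) + 1 : ℝ) ^ c * ((2 * (β * d * b ^ 2)) ^ G₀ / G₀.factorial) ≤ 1) :
    RProgram.SolvesAPTI ((aptiCmd N c).compile 0) d L Lp β b δ (aptiTime c d (Lp + L) G₀) := by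
  intro Q K V hQKV
  set s₀ := aptiInput Lp L d β Q K V with hs₀
  have hN' : (8 : ℝ) ≤ N := by exact_mod_cast hN
  have hn1 : (1 : ℝ) ≤ ((Lp + L : ℕ) + 1 : ℝ) ^ c :=
    one_le_pow₀ (le_add_of_nonneg_left (Nat.cast_nonneg _))
  have hpos : (8 : ℝ) ≤ N * ((Lp + L : ℕ) + 1 : ℝ) ^ c := by nlinarith
  have h := wp_aptiCmd (Lp := Lp) (L := L) (d := d) (N := N) (c := c) (G₀ := G₀) (β := β) (b := b)
    (m := s₀.fmem) (s := s₀.store) rfl rfl rfl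
    (fun r hr => by
      simp only [RState.store, hs₀, aptiInput]
      rw [if_neg (by omega), if_neg (by omega), if_neg (by omega)]) rfl
    (fun r hr => by
      simp only [RState.store, hs₀, aptiInput]
      rw [if_neg (by omega)]) rfl rfl hβ hb
    (fun a _ => abs_aptiInput_fmem_le hb hQKV a) (by omega) hG
  have hrun := h.run
  change RProgram.Halted _ (RProgram.run _ _ s₀) ∧ _ at hrun
  obtain ⟨hhalt, M, G, hM, hG1, hall, hGM, hout⟩ := hrun
  refine ⟨hhalt, (maxNorm_le_iff _ (le_trans (by positivity) hδ)).2 fun i j => ?_⟩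
  have hlt := mul_add_lt_mul i.isLt j.isLt
  have hout' := hout _ hlt
  rw [Matrix.sub_apply, readOutput, Matrix.of_apply]
  change |(RProgram.run ((aptiCmd N c).compile 0) _ s₀).store.fmem (d * j + i) - _| ≤ δ
  rw [show s₀ = s₀.store.at 0 from rfl, hout', attention_apply]
  refine (abs_quotient_sub_le (ε := 8 / (N * ((Lp + L : ℕ) + 1 : ℝ) ^ c)) hβ hM ?_ (by positivity) hall
    (fun a ha => aptiInput_fmem_of_le ha) hG1 ?_ i.isLt j.isLt).trans hδ
  · rw [div_le_one (by linarith)]; exact hpos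
  · refine le_trans (le_of_eq ?_) hGM
    field_simp

/-! ### Growth rates -/

/-- `f n ≤ n ^ o(1)`. -/
def Subpolynomial (f : ℕ → ℝ) : Prop := ∀ ε : ℝ, 0 < ε → ∀ᶠ n : ℕ in atTop, f n ≤ (n : ℝ) ^ ε

theorem Subpolynomial.mul {f g : ℕ → ℝ} (hf : Subpolynomial f) (hg : Subpolynomial g)
    (hg0 : ∀ n, 0 ≤ g n) : Subpolynomial fun n => f n * g n := by
  intro ε hε
  filter_upwards [hf (ε / 2) (by linarith), hg (ε / 2) (by linarith), eventually_gt_atTop 0]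
    with n h1 h2 hn
  have hn' : (0 : ℝ) < n := by exact_mod_cast hn
  calc f n * g n ≤ (n : ℝ) ^ (ε / 2) * (n : ℝ) ^ (ε / 2) :=
        mul_le_mul h1 h2 (hg0 n) (Real.rpow_nonneg hn'.le _)
    _ = (n : ℝ) ^ ε := by rw [← Real.rpow_add hn', add_halves]

theorem tendsto_log_natCast : Tendsto (fun n : ℕ => Real.log n) atTop atTop :=
  Real.tendsto_log_atTop.comp tendsto_natCast_atTop_atTop

theorem subpolynomial_of_le_log {f : ℕ → ℝ} {C : ℝ} (h : ∀ᶠ n : ℕ in atTop, f n ≤ C * Real.log n) :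
    Subpolynomial f := by
  intro ε hε
  have h1 : (fun n : ℕ => C * Real.log n) =o[atTop] fun n : ℕ => (n : ℝ) ^ ε :=
    ((isLittleO_log_rpow_atTop hε).comp_tendsto tendsto_natCast_atTop_atTop).const_mul_left C
  filter_upwards [h, h1.bound one_pos] with n h2 h3
  rw [one_mul, Real.norm_of_nonneg (Real.rpow_nonneg (Nat.cast_nonneg n) _)] at h3
  exact h2.trans ((le_abs_self _).trans h3)

theorem subpolynomial_const (C : ℝ) : Subpolynomial fun _ => C := by
  refine subpolynomial_of_le_log (C := |C|) ?_
  filter_upwards [tendsto_log_natCast.eventually_ge_atTop 1] with n hn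
  exact (le_abs_self C).trans (le_mul_of_one_le_right (abs_nonneg C) hn)

theorem almostLinear_of_forall {T : ℕ → ℕ}
    (h : ∀ ε : ℝ, 0 < ε → ∀ᶠ n : ℕ in atTop, (T n : ℝ) ≤ (n : ℝ) ^ (1 + ε)) : AlmostLinear T := by
  -- The least nonnegative exponent that works for `n ≥ 2`; it is zero when `T n = 0`, because
  -- `Real.log 0 = 0`.
  refine ⟨fun n => max 0 (Real.log (T n) / Real.log n - 1), ?_, ?_⟩
  · rw [Metric.tendsto_nhds]
    intro ε hε
    filter_upwards [h (ε / 2) (by linarith), eventually_ge_atTop 2] with n hn hn2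
    have hn' : (1 : ℝ) < n := by exact_mod_cast hn2
    have hlog : 0 < Real.log n := Real.log_pos hn'
    rw [Real.dist_eq, sub_zero, abs_of_nonneg (le_max_left _ _)]
    refine max_lt hε ?_
    rcases Nat.eq_zero_or_pos (T n) with h0 | h0
    · rw [h0]
      simp
      linarith
    · have h1 : Real.log (T n) ≤ (1 + ε / 2) * Real.log n := by
        rw [← Real.log_rpow (by linarith)]
        exact Real.log_le_log (by exact_mod_cast h0) hn
      have h2 : Real.log (T n) / Real.log n ≤ 1 + ε / 2 := by rwa [div_le_iff₀ hlog]
      linarith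
  · filter_upwards [eventually_ge_atTop 2] with n hn2
    have hn' : (1 : ℝ) < n := by exact_mod_cast hn2
    have hlog : 0 < Real.log n := Real.log_pos hn'
    rcases Nat.eq_zero_or_pos (T n) with h0 | h0
    · rw [h0, Nat.cast_zero]
      exact Real.rpow_nonneg (by linarith) _
    · have h0' : (0 : ℝ) < T n := by exact_mod_cast h0
      calc (T n : ℝ) = (n : ℝ) ^ (Real.log (T n) / Real.log n) := by
            rw [Real.rpow_def_of_pos (by linarith), mul_div_cancel₀ _ hlog.ne', Real.exp_log h0']
        _ ≤ _ := Real.rpow_le_rpow_of_exponent_le hn'.le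
            (by linarith [le_max_right 0 (Real.log (T n) / Real.log n - 1)])

theorem almostLinear_of_le_mul {T : ℕ → ℕ} {f : ℕ → ℝ} (hf : Subpolynomial f)
    (h : ∀ n, 1 ≤ n → (T n : ℝ) ≤ n * f n) : AlmostLinear T := by
  refine almostLinear_of_forall fun ε hε => ?_
  filter_upwards [hf ε hε, eventually_ge_atTop 1] with n h1 hn
  have hn' : (0 : ℝ) < n := by exact_mod_cast hn
  calc (T n : ℝ) ≤ n * f n := h n hn
    _ ≤ n * (n : ℝ) ^ ε := by gcongr
    _ = (n : ℝ) ^ (1 + ε) := by rw [Real.rpow_add hn', Real.rpow_one]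

/-- The left side is one term of the binomial expansion of `(t + 1) ^ (d + g)`. A small `t` makes
the exponent small at the price of a factor `t ^ (-g)`. -/
theorem choose_mul_pow_le (d g : ℕ) {t : ℝ} (ht : 0 ≤ t) :
    ((d + g).choose d : ℝ) * t ^ g ≤ Real.exp (t * (d + g)) := by
  calc ((d + g).choose d : ℝ) * t ^ g = t ^ g * 1 ^ (d + g - g) * ((d + g).choose g : ℝ) := by
        rw [Nat.choose_symm_add]; ring
    _ ≤ (t + 1) ^ (d + g) := by
        rw [add_pow]
        exact Finset.single_le_sum
          (f := fun m => t ^ m * 1 ^ (d + g - m) * ((d + g).choose m : ℝ))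
          (fun m _ => by positivity) (Finset.mem_range.2 (by omega))
    _ ≤ Real.exp t ^ (d + g) := by
        gcongr
        exact Real.add_one_le_exp t
    _ = Real.exp (t * (d + g)) := by
        rw [← Real.exp_nat_mul]
        push_cast
        ring_nf

theorem subpolynomial_choose {d g : ℕ → ℕ} {D : ℝ} (hD : 0 < D)
    (hd : ∀ᶠ n : ℕ in atTop, (d n : ℝ) ≤ D * Real.log n)
    (hg : ∀ η > 0, ∀ᶠ n : ℕ in atTop, (g n : ℝ) ≤ η * Real.log n) :
    Subpolynomial fun n => ((d n + g n).choose (d n) : ℝ) := by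
  intro ε hε
  -- First `t` is fixed so that `t * (d + g)` costs at most `ε / 2 * log n`; only then is `η`
  -- chosen, so that `g * log (1 / t)` costs at most the same.
  set t : ℝ := min (1 / 2) (ε / (2 * (D + 1))) with ht
  have ht0 : 0 < t := lt_min (by norm_num) (by positivity)
  have ht1 : t ≤ 1 / 2 := min_le_left _ _
  have ht2 : t * (2 * (D + 1)) ≤ ε := by
    have : t ≤ ε / (2 * (D + 1)) := min_le_right _ _
    rwa [le_div_iff₀ (by positivity)] at this
  set τ : ℝ := -Real.log t with hτ
  have hτ0 : 0 < τ := by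
    have := Real.log_neg ht0 (by linarith)
    linarith
  have htτ : t = Real.exp (-τ) := by rw [hτ, neg_neg, Real.exp_log ht0]
  set η : ℝ := min 1 (ε / (2 * τ)) with hη
  have hη0 : 0 < η := lt_min one_pos (by positivity)
  have hη1 : η ≤ 1 := min_le_left _ _
  have hη2 : η * (2 * τ) ≤ ε := by
    have : η ≤ ε / (2 * τ) := min_le_right _ _
    rwa [le_div_iff₀ (by positivity)] at this
  filter_upwards [hd, hg η hη0, eventually_ge_atTop 1] with n h1 h2 hn
  have hn' : (0 : ℝ) < n := by exact_mod_cast hn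
  have hlog : 0 ≤ Real.log n := Real.log_nonneg (by exact_mod_cast hn)
  have h3 := choose_mul_pow_le (d n) (g n) ht0.le
  have h4 : t ^ g n = Real.exp (-(τ * g n)) := by
    rw [htτ, ← Real.exp_nat_mul]; ring_nf
  calc ((d n + g n).choose (d n) : ℝ)
      = ((d n + g n).choose (d n) : ℝ) * t ^ g n * Real.exp (τ * g n) := by
        rw [h4, mul_assoc, ← Real.exp_add]; simp
    _ ≤ Real.exp (t * (d n + g n)) * Real.exp (τ * g n) := by gcongr
    _ = Real.exp (t * (d n + g n) + τ * g n) := (Real.exp_add _ _).symm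
    _ ≤ Real.exp (Real.log n * ε) := by
        refine Real.exp_le_exp.2 ?_
        calc t * (d n + g n) + τ * g n
            ≤ t * (D * Real.log n + 1 * Real.log n) + τ * (η * Real.log n) := by
              gcongr
              exact h2.trans (by gcongr)
          _ = (t * (2 * (D + 1)) / 2 + η * (2 * τ) / 2) * Real.log n := by ring
          _ ≤ (ε / 2 + ε / 2) * Real.log n := by gcongr
          _ = Real.log n * ε := by ring
    _ = (n : ℝ) ^ ε := (Real.rpow_def_of_pos hn' _).symm

/-! ### The truncation order -/

/-- Compare one term of the exponential series at `y * exp a` with its sum. The free parameter `a`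
is the rate of decay in `G`. -/
theorem pow_div_factorial_le_exp {y : ℝ} (hy : 0 ≤ y) (a : ℝ) (G : ℕ) :
    y ^ G / G.factorial ≤ Real.exp (y * Real.exp a - a * G) := by
  have hA : (0 : ℝ) < Real.exp a := Real.exp_pos a
  have h := Real.pow_div_factorial_le_exp (y * Real.exp a) (by positivity) G
  rw [mul_pow, ← Real.exp_nat_mul] at h
  rw [Real.exp_sub, le_div_iff₀ (Real.exp_pos _), mul_comm a]
  refine le_trans (le_of_eq ?_) h
  ring

/-- The least order that satisfies the accuracy condition. -/
def leastOrder (W y : ℝ) : ℕ := sInf {G : ℕ | W * (y ^ G / G.factorial) ≤ 1}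

theorem leastOrder_spec (W y : ℝ) :
    W * (y ^ leastOrder W y / (leastOrder W y).factorial) ≤ 1 := by
  have h : {G : ℕ | W * (y ^ G / G.factorial) ≤ 1}.Nonempty := by
    have := (FloorSemiring.tendsto_pow_div_factorial_atTop y).const_mul W
    rw [mul_zero] at this
    exact (this.eventually_le_const one_pos).exists
  exact Nat.sInf_mem h

theorem leastOrder_le_log {W y : ℕ → ℝ} (hy : ∀ n, 0 ≤ y n) (C : ℕ)
    (hW : ∀ᶠ n : ℕ in atTop, W n ≤ (n : ℝ) ^ C) (hyl : y =o[atTop] fun n : ℕ => Real.log n) :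
    ∀ η > 0, ∀ᶠ n : ℕ in atTop, (leastOrder (W n) (y n) : ℝ) ≤ η * Real.log n := by
  intro η hη
  -- At the order `⌈η / 2 * log n⌉` the decay is at least `n ^ (-(C + 1))`: `C` powers cancel `W`,
  -- and the last one absorbs `y * exp a ≤ log n`. The other half of `η` pays for rounding up.
  set a : ℝ := (C + 1) / (η / 2) with ha
  have ha0 : 0 < a := by positivity
  have haη : a * (η / 2) = C + 1 := by rw [ha]; field_simp
  filter_upwards [hW, hyl.bound (Real.exp_pos (-a)), eventually_ge_atTop 1,
    tendsto_log_natCast.eventually_ge_atTop (2 / η)] with n h1 h2 hn h3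
  have hn' : (0 : ℝ) < n := by exact_mod_cast hn
  have hlog : 0 ≤ Real.log n := Real.log_nonneg (by exact_mod_cast hn)
  rw [Real.norm_of_nonneg (hy n), Real.norm_of_nonneg hlog] at h2
  set G := ⌈η / 2 * Real.log n⌉₊ with hG
  have hGle : η / 2 * Real.log n ≤ G := Nat.le_ceil _
  have hmem : W n * (y n ^ G / G.factorial) ≤ 1 := by
    calc W n * (y n ^ G / G.factorial)
        ≤ (n : ℝ) ^ C * Real.exp (y n * Real.exp a - a * G) := by
          have := hy n
          exact mul_le_mul h1 (pow_div_factorial_le_exp (hy n) a G) (by positivity) (by positivity)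
      _ = Real.exp (C * Real.log n + (y n * Real.exp a - a * G)) := by
          rw [Real.exp_add, Real.exp_nat_mul, Real.exp_log hn']
      _ ≤ 1 := by
          rw [Real.exp_le_one_iff]
          have e1 : y n * Real.exp a ≤ Real.log n := by
            calc y n * Real.exp a ≤ Real.exp (-a) * Real.log n * Real.exp a := by gcongr
              _ = Real.exp (-a + a) * Real.log n := by rw [Real.exp_add]; ring
              _ = Real.log n := by simp
          have e2 : (C + 1) * Real.log n ≤ a * G := by
            rw [← haη, mul_assoc]
            gcongr
          linarith
  have hle : leastOrder (W n) (y n) ≤ G := Nat.sInf_le hmem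
  have hlt : (G : ℝ) < η / 2 * Real.log n + 1 := Nat.ceil_lt_add_one (by positivity)
  have h4 : 1 ≤ η / 2 * Real.log n := by
    rw [div_le_iff₀ hη] at h3
    linarith
  have hle' : (leastOrder (W n) (y n) : ℝ) ≤ G := by exact_mod_cast hle
  linarith

/-! ### The running time -/

theorem aptiTime_le (c d n G : ℕ) (hn : 1 ≤ n) :
    aptiTime c d n G ≤ n * ((4 * c + 300) * (d + 1) * (d + 1) * (G + 1) * (d + G).choose d) := by
  have hch : 1 ≤ (d + G).choose d := Nat.choose_pos (Nat.le_add_right d G)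
  -- With `n` and the binomial coefficient written as successors, both sides expand into polynomials
  -- that can be compared coefficient by coefficient.
  obtain ⟨n, rfl⟩ := Nat.exists_eq_add_of_le' hn
  obtain ⟨C, hC⟩ := Nat.exists_eq_add_of_le' hch
  unfold aptiTime contribTime
  rw [hC]
  ring_nf
  omega

theorem exists_accuracy_constant {δ : ℕ → ℝ} (hδ_pos : ∀ n, 0 < δ n) {c : ℕ}
    (hδ : ∀ᶠ n : ℕ in atTop, 1 / (n : ℝ) ^ c ≤ δ n) :
    ∃ N : ℕ, 8 ≤ N ∧ ∀ n : ℕ, 8 / (N * ((n : ℝ) + 1) ^ c) ≤ δ n := by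
  obtain ⟨n₀, h₀⟩ := eventually_atTop.1 hδ
  -- The sum takes care of the finitely many `n` for which the polynomial lower bound on `δ` may
  -- fail. The range includes `n₀`, so the remaining `n` are positive.
  refine ⟨8 + ∑ n ∈ Finset.range (n₀ + 1), ⌈8 / δ n⌉₊, by omega, fun n => ?_⟩
  set N := 8 + ∑ n ∈ Finset.range (n₀ + 1), ⌈8 / δ n⌉₊ with hN
  have hN8 : (8 : ℝ) ≤ N := by exact_mod_cast (show 8 ≤ N by omega)
  have hn1 : (1 : ℝ) ≤ ((n : ℝ) + 1) ^ c := one_le_pow₀ (le_add_of_nonneg_left (Nat.cast_nonneg _))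
  rcases Nat.lt_or_ge n (n₀ + 1) with h | h
  · have h1 : ⌈8 / δ n⌉₊ ≤ N := by
      have := Finset.single_le_sum (f := fun n => ⌈8 / δ n⌉₊) (fun _ _ => Nat.zero_le _)
        (Finset.mem_range.2 h)
      omega
    have h2 : 8 / δ n ≤ N := (Nat.le_ceil _).trans (by exact_mod_cast h1)
    rw [div_le_iff₀ (hδ_pos n)] at h2
    rw [div_le_iff₀ (by positivity)]
    calc (8 : ℝ) ≤ N * δ n := h2
      _ ≤ N * δ n * ((n : ℝ) + 1) ^ c :=
        le_mul_of_one_le_right (mul_nonneg (by linarith) (hδ_pos n).le) hn1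
      _ = _ := by ring
  · refine le_trans ?_ (h₀ n (by omega))
    have hn0 : (0 : ℝ) < n := by exact_mod_cast (show 0 < n by omega)
    rw [div_le_div_iff₀ (by positivity) (by positivity), one_mul]
    gcongr
    linarith

/-! ### The main theorem. -/

theorem mainTheorem7 (d : ℕ → ℕ) (B β δ : ℕ → ℝ)
    (hB_pos : ∀ n, 0 < B n) (hβ_pos : ∀ n, 0 < β n) (hδ_pos : ∀ n, 0 < δ n)
    (hd : (fun n : ℕ => (d n : ℝ)) =O[atTop] fun n : ℕ => Real.log n)
    (hB : B =o[atTop] fun n : ℕ => Real.sqrt (Real.log n))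
    (hβ : (fun n : ℕ => β n * d n * B n ^ 2) =o[atTop] fun n : ℕ => Real.log n)
    (hδ : ∃ c : ℕ, ∀ᶠ n : ℕ in atTop, 1 / (n : ℝ) ^ c ≤ δ n) :
    ∃ (P : RProgram) (T : ℕ → ℕ), AlmostLinear T ∧
      ∀ Lp L : ℕ, P.SolvesAPTI (d (Lp + L)) L Lp (β (Lp + L)) (B (Lp + L)) (δ (Lp + L))
        (T (Lp + L)) := by
  obtain ⟨c, hc⟩ := hδ
  obtain ⟨N, hN8, hN⟩ := exists_accuracy_constant hδ_pos hc
  set W : ℕ → ℝ := fun n => (B n + 1) * N * ((n : ℝ) + 1) ^ c with hW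
  set y : ℕ → ℝ := fun n => 2 * (β n * d n * B n ^ 2) with hy
  -- This order, computed from `B n`, occurs only in the time bound; the program finds its own,
  -- which is never larger.
  set g : ℕ → ℕ := fun n => leastOrder (W n) (y n) with hg
  have hy0 : ∀ n, 0 ≤ y n := fun n => by
    have := hβ_pos n
    positivity
  -- Eventually `B n + 1 ≤ n ^ 2`, `N ≤ n` and `n + 1 ≤ n ^ 2`, which accounts for the exponent.
  have hWle : ∀ᶠ n : ℕ in atTop, W n ≤ (n : ℝ) ^ (3 + 2 * c) := by
    filter_upwards [hB.bound one_pos, eventually_ge_atTop N] with n h1 h2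
    have hn2 : (2 : ℝ) ≤ n := by exact_mod_cast (show 2 ≤ n by omega)
    have hlog : Real.log n ≤ n := (Real.log_le_sub_one_of_pos (by linarith)).trans (by linarith)
    have hB1 : B n ≤ n := by
      rw [one_mul, Real.norm_of_nonneg (hB_pos n).le, Real.norm_of_nonneg (Real.sqrt_nonneg _)] at h1
      refine h1.trans (Real.sqrt_le_iff.2 ⟨by linarith, by nlinarith⟩)
    have hn1 : (n : ℝ) + 1 ≤ (n : ℝ) ^ 2 := by nlinarith
    have hNn : (N : ℝ) ≤ n := by exact_mod_cast h2
    have hBp := hB_pos n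
    calc W n ≤ (n : ℝ) ^ 2 * n * ((n : ℝ) ^ 2) ^ c := by
          simp only [hW]
          gcongr
          linarith
      _ = (n : ℝ) ^ (3 + 2 * c) := by rw [← pow_mul, pow_add]; ring
  have hgl := leastOrder_le_log hy0 _ hWle (hβ.const_mul_left 2)
  obtain ⟨D, hD, hdD⟩ := hd.exists_pos
  have hdl : ∀ᶠ n : ℕ in atTop, (d n : ℝ) ≤ D * Real.log n := by
    filter_upwards [hdD.bound, eventually_ge_atTop 1] with n h hn
    rwa [Real.norm_of_nonneg (Nat.cast_nonneg _),
      Real.norm_of_nonneg (Real.log_nonneg (by exact_mod_cast hn))] at h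
  have hd1 : Subpolynomial fun n => (d n : ℝ) + 1 := by
    refine subpolynomial_of_le_log (C := D + 1) ?_
    filter_upwards [hdl, tendsto_log_natCast.eventually_ge_atTop 1] with n h1 h2
    linarith
  have hg1 : Subpolynomial fun n => (g n : ℝ) + 1 := by
    refine subpolynomial_of_le_log (C := 2) ?_
    filter_upwards [hgl 1 one_pos, tendsto_log_natCast.eventually_ge_atTop 1] with n h1 h2
    linarith
  have hf : Subpolynomial fun n => (4 * c + 300) * ((d n : ℝ) + 1) * ((d n : ℝ) + 1) * ((g n : ℝ) + 1)
      * ((d n + g n).choose (d n) : ℝ) :=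
    ((((subpolynomial_const _).mul hd1 fun _ => by positivity).mul hd1 fun _ => by positivity).mul
      hg1 fun _ => by positivity).mul (subpolynomial_choose hD hdl hgl) fun _ => by positivity
  refine ⟨(aptiCmd N c).compile 0, fun n => aptiTime c (d n) n (g n),
    almostLinear_of_le_mul hf fun n hn => ?_, fun Lp L => ?_⟩
  · exact_mod_cast aptiTime_le c (d n) n (g n) hn
  · exact solvesAPTI_aptiCmd (hβ_pos _).le (hB_pos _).le hN8 (hN (Lp + L)) (leastOrder_spec _ _)

end
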